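/- Let $M$ be a Riemannian manifold (smooth, Hausdorff, second countable, without boundary, of dimension $n$) with Riemannian distance $d$ (so $d=\infty$ between different components), and let $\mathrm{vol}$ be a smooth positive density on $M$, for example the Riemannian volume. Let $E\to M$ and $E'\to M$ be smooth real vector bundles of finite rank, with dual bundles $E^*$, $E'^*$, and let $E$ carry a Riemannian metric with norm $|\cdot|$. Let $L:C^\infty(M,E)\to C^\infty(M,E')$ be a linear differential operator with smooth coefficients of order (at most) $k$, where $k\ge 1$. For open $\Omega\subset M$ let $\mathcal D(\Omega,E^*)$ be the space of smooth sections of $E^*$ with compact support in $\Omega$ and $\mathcal D'(\Omega,E)$ its topological dual, the distributional sections of $E$ over $\Omega$. A smooth section $v$ of $E$ over $\Omega$ is regarded as the distribution $\varphi\mapsto\int_\Omega\langle v,\varphi\rangle\,\mathrm{vol}$. For $T\in\mathcal D'(\Omega,E)$ put $(LT)[\varphi]=T[L^*\varphi]$ for $\varphi\in\mathcal D(\Omega,E'^*)$, where $L^*$ is the formally dual operator, characterized by $\int_M\langle Lv,\varphi\rangle\,\mathrm{vol}=\int_M\langle v,L^*\varphi\rangle\,\mathrm{vol}$ for all $v \in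 C^\infty(M,E)$ and all smooth compactly supported sections $\varphi$ of $E'^*$. Assume that $L$ is weakly hypoelliptic: for every open $\Omega\subset M$, every $T\in\mathcal D'(\Omega,E)$ with $LT=0$ is a smooth section of $E$ over $\Omega$. Let $\mathcal H(\Omega,L)$ denote the space of all smooth sections $v$ of $E$ over $\Omega$ with $Lv=0$. Let $S\subset M$ be an embedded submanifold (without boundary) of codimension $m\ge 1$ which is a closed subset of $M$, and for $r>0$ let $$N(S,r)=\{x\in M: d(x,S)\le r\}\setminus S,\qquad d(x,S)=\inf_{y\in S}d(x,y),$$ with $d(x,\emptyset)=\infty$. Let $u\in\mathcal H(M\setminus S,L)$ and suppose that for each compact $K\subset M$ $$\int_{N(S,r)\cap K}|u|\,\mathrm{vol}=\mathrm o(r^k)\qquad\text{as } r\searrow 0 .$$ Then there is exactly one $\bar u\in\mathcal H(M,L)$ with $\bar u=u$ on $M\setminus S$. -/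

import Mathlib

open Bundle Set Filter Topology MeasureTheory Manifold
open scoped ContDiff ENNReal

noncomputable section

namespace DiffOp

/-! ### Sections of vector bundles in local coordinates -/

section Sections

variable {n : ℕ} {M : Type*} [TopologicalSpace M] [ChartedSpace (EuclideanSpace ℝ (Fin n)) M]
  (F : Type*) [NormedAddCommGroup F] [NormedSpace ℝ F]
  (E : M → Type*) [∀ x, AddCommGroup (E x)] [∀ x, Module ℝ (E x)] [∀ x, TopologicalSpace (E x)]
  [TopologicalSpace (TotalSpace F E)] [FiberBundle F E]

/-- The open neighbourhood of `p` on which the preferred chart at `p` is defined and the bundle `E`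
is trivialized by its preferred trivialization at `p`. -/
def patch (p : M) : Set M :=
  (chartAt (EuclideanSpace ℝ (Fin n)) p).source ∩ (trivializationAt F E p).baseSet

/-- The expression of a section `v` of `E` in the preferred chart and trivialization at `p`:
a function on (an open subset of) `ℝⁿ` with values in the model fibre `F`. It is meaningful on the
image of the patch at `p`. -/
def localRep (p : M) (v : ∀ x, E x) (y : EuclideanSpace ℝ (Fin n)) : F :=
  (trivializationAt F E p
    ⟨(chartAt (EuclideanSpace ℝ (Fin n)) p).symm y,
      v ((chartAt (EuclideanSpace ℝ (Fin n)) p).symm y)⟩).2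

/-- `v` is a smooth section of `E` over the set `Ω`; its values outside `Ω` are irrelevant. -/
def IsSmoothOn (Ω : Set M) (v : ∀ x, E x) : Prop :=
  ContMDiffOn (𝓡 n) ((𝓡 n).prod 𝓘(ℝ, F)) ∞ (fun x => TotalSpace.mk' F x (v x)) Ω

variable {E} in
/-- The support of a section. -/
def sectionSupport (v : ∀ x, E x) : Set M := closure {x | v x ≠ 0}

variable [VectorBundle ℝ F E]

/-- The space `𝒟(Ω, E)` of test sections: smooth sections of `E` with compact support contained
in `Ω`. -/
def testSections (Ω : Set M) : Submodule ℝ Cₛ^∞⟮𝓡 n; F, E⟯ where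
  carrier := {φ | IsCompact (sectionSupport ⇑φ) ∧ sectionSupport ⇑φ ⊆ Ω}
  zero_mem' := by
    have h : sectionSupport (⇑(0 : Cₛ^∞⟮𝓡 n; F, E⟯)) = ∅ := by simp [sectionSupport]
    exact ⟨h ▸ isCompact_empty, h ▸ empty_subset Ω⟩
  add_mem' := by
    intro a b ha hb
    have h : sectionSupport (⇑(a + b)) ⊆ sectionSupport ⇑a ∪ sectionSupport ⇑b := by
      unfold sectionSupport
      rw [← closure_union]
      refine closure_mono fun x hx => ?_
      by_contra hc
      simp only [mem_union, mem_ofPred_eq, not_or, not_not] at hc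
      exact hx (by simp [hc.1, hc.2])
    exact ⟨(ha.1.union hb.1).of_isClosed_subset isClosed_closure h,
      h.trans (union_subset ha.2 hb.2)⟩
  smul_mem' := by
    intro c a ha
    have h : sectionSupport (⇑(c • a)) ⊆ sectionSupport ⇑a := by
      refine closure_mono fun x hx hc => hx ?_
      simp [hc]
    exact ⟨ha.1.of_isClosed_subset isClosed_closure h, h.trans ha.2⟩

/-- Convergence to `0` in `𝒟(Ω, E)`: all supports lie in one compact subset of `Ω`, and in all
local coordinates the derivatives of every order converge to `0` uniformly on compact sets. -/
def TestTendstoZero (Ω : Set M) (φ : ℕ → testSections (n := n) F E Ω) : Prop :=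
  (∃ K ⊆ Ω, IsCompact K ∧ ∀ i, sectionSupport ⇑(φ i).1 ⊆ K) ∧
  ∀ (p : M) (C : Set M), C ⊆ patch (n := n) F E p → IsCompact C → ∀ j : ℕ,
    TendstoUniformlyOn (fun i => iteratedFDeriv ℝ j (localRep F E p ⇑(φ i).1)) 0 atTop
      (chartAt (EuclideanSpace ℝ (Fin n)) p '' C)

end Sections

/-- The fibres `E x →L[ℝ] ℝ` of the dual bundle `E*`; the model fibre is `F →L[ℝ] ℝ`. -/
abbrev Dual {M : Type*} (E : M → Type*) [∀ x, AddCommGroup (E x)] [∀ x, Module ℝ (E x)]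
    [∀ x, TopologicalSpace (E x)] (x : M) : Type _ :=
  E x →L[ℝ] Bundle.Trivial M ℝ x

/-! ### Distributional sections and differential operators -/

section Operators

variable {n : ℕ} {M : Type*} [TopologicalSpace M] [ChartedSpace (EuclideanSpace ℝ (Fin n)) M]
  (F : Type*) [NormedAddCommGroup F] [NormedSpace ℝ F]
  (E : M → Type*) [∀ x, AddCommGroup (E x)] [∀ x, Module ℝ (E x)] [∀ x, TopologicalSpace (E x)]
  [TopologicalSpace (TotalSpace F E)] [FiberBundle F E] [VectorBundle ℝ F E]
  (F' : Type*) [NormedAddCommGroup F'] [NormedSpace ℝ F']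
  (E' : M → Type*) [∀ x, AddCommGroup (E' x)] [∀ x, Module ℝ (E' x)]
  [∀ x, TopologicalSpace (E' x)]
  [TopologicalSpace (TotalSpace F' E')] [FiberBundle F' E'] [VectorBundle ℝ F' E']

/-- The space `𝒟'(Ω, E)` of distributional sections of `E` over `Ω`: (sequentially) continuous
linear functionals on the space `𝒟(Ω, E*)` of test sections of the dual bundle. -/
structure DistSection (n : ℕ) {M : Type*} [TopologicalSpace M]
    [ChartedSpace (EuclideanSpace ℝ (Fin n)) M]
    (F : Type*) [NormedAddCommGroup F] [NormedSpace ℝ F]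
    (E : M → Type*) [∀ x, AddCommGroup (E x)] [∀ x, Module ℝ (E x)]
    [∀ x, TopologicalSpace (E x)]
    [TopologicalSpace (TotalSpace F E)] [FiberBundle F E] [VectorBundle ℝ F E] (Ω : Set M) where
  /-- the underlying linear functional -/
  eval : testSections (n := n) (F →L[ℝ] ℝ) (Dual E) Ω →ₗ[ℝ] ℝ
  continuous_eval : ∀ φ : ℕ → testSections (n := n) (F →L[ℝ] ℝ) (Dual E) Ω,
    TestTendstoZero (F →L[ℝ] ℝ) (Dual E) Ω φ → Tendsto (fun i => eval (φ i)) atTop (𝓝 0)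

variable {F E F' E'}

/-- `L : C^∞(M, E) → C^∞(M, E')` is a linear differential operator of order (at most) `k`: in local
coordinates `L v = ∑_{j ≤ k} A_j · D^j v` with smooth coefficients `A_j`. Here the coefficient `A_j`
is a linear map applied to the `j`-th total derivative, that is, to the collection of all partial
derivatives of order `j`. -/
def IsDiffOp (k : ℕ) (L : Cₛ^∞⟮𝓡 n; F, E⟯ →ₗ[ℝ] Cₛ^∞⟮𝓡 n; F', E'⟯) : Prop :=
  ∀ p : M, ∃ A : ∀ j : ℕ, EuclideanSpace ℝ (Fin n) →
      ((EuclideanSpace ℝ (Fin n) [×j]→L[ℝ] F) →L[ℝ] F'),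
    (∀ j ≤ k, ContDiffOn ℝ ∞ (A j) (chartAt (EuclideanSpace ℝ (Fin n)) p ''
      (patch (n := n) F E p ∩ patch (n := n) F' E' p))) ∧
    ∀ v : Cₛ^∞⟮𝓡 n; F, E⟯,
      ∀ y ∈ chartAt (EuclideanSpace ℝ (Fin n)) p ''
          (patch (n := n) F E p ∩ patch (n := n) F' E' p),
        localRep F' E' p ⇑(L v) y =
          ∑ j ∈ Finset.range (k + 1), A j y (iteratedFDeriv ℝ j (localRep F E p ⇑v) y)

variable [MeasurableSpace M] (vol : Measure M)

/-- The operator `A : 𝒟(Ω, E'*) → 𝒟(Ω, E*)` is formally dual to `L` with respect to `vol`: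
`∫ ⟨L v, φ⟩ vol = ∫ ⟨v, A φ⟩ vol` for all smooth sections `v` of `E` and all test sections `φ` of
`E'*` over `Ω`. -/
def IsFormalDual (L : Cₛ^∞⟮𝓡 n; F, E⟯ →ₗ[ℝ] Cₛ^∞⟮𝓡 n; F', E'⟯) (Ω : Set M)
    (A : testSections (n := n) (F' →L[ℝ] ℝ) (Dual E') Ω →ₗ[ℝ]
      testSections (n := n) (F →L[ℝ] ℝ) (Dual E) Ω) : Prop :=
  ∀ (v : Cₛ^∞⟮𝓡 n; F, E⟯) (φ : testSections (n := n) (F' →L[ℝ] ℝ) (Dual E') Ω),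
    (∫ x, (φ.1 x (L v x) : ℝ) ∂vol) = ∫ x, ((A φ).1 x (v x) : ℝ) ∂vol

open Classical in
/-- The formally dual operator `L*`, acting on test sections over `Ω`. For a linear differential
operator `L`, an open set `Ω` and a smooth positive density `vol`, a formally dual operator exists
and is unique, so that the default value `0` plays no role. -/
def formalDual (L : Cₛ^∞⟮𝓡 n; F, E⟯ →ₗ[ℝ] Cₛ^∞⟮𝓡 n; F', E'⟯) (Ω : Set M) :
    testSections (n := n) (F' →L[ℝ] ℝ) (Dual E') Ω →ₗ[ℝ]
      testSections (n := n) (F →L[ℝ] ℝ) (Dual E) Ω :=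
  if h : ∃ A, IsFormalDual vol L Ω A then h.choose else 0

/-- The linear functional `L T`, `(L T)[φ] = T[L* φ]`, for a distributional section `T`. -/
def applyDist (L : Cₛ^∞⟮𝓡 n; F, E⟯ →ₗ[ℝ] Cₛ^∞⟮𝓡 n; F', E'⟯) (Ω : Set M)
    (T : DistSection n F E Ω) : testSections (n := n) (F' →L[ℝ] ℝ) (Dual E') Ω →ₗ[ℝ] ℝ :=
  T.eval ∘ₗ formalDual vol L Ω

/-- The distributional section `T` over `Ω` is (given by) the smooth section `v`. -/
def IsGivenBy (Ω : Set M) (T : DistSection n F E Ω) (v : ∀ x, E x) : Prop :=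
  IsSmoothOn (n := n) F E Ω v ∧
    ∀ φ : testSections (n := n) (F →L[ℝ] ℝ) (Dual E) Ω, T.eval φ = ∫ x, (φ.1 x (v x) : ℝ) ∂vol

/-- `L` is weakly hypoelliptic: over every open set, every distributional solution of `L T = 0`
is smooth. -/
def IsWeaklyHypoelliptic (L : Cₛ^∞⟮𝓡 n; F, E⟯ →ₗ[ℝ] Cₛ^∞⟮𝓡 n; F', E'⟯) : Prop :=
  ∀ Ω : Set M, IsOpen Ω → ∀ T : DistSection n F E Ω, applyDist vol L Ω T = 0 →
    ∃ v : ∀ x, E x, IsGivenBy vol Ω T v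

/-- The space `ℋ(Ω, L)` of solutions over the open set `Ω`: smooth sections over `Ω` (with arbitrary
irrelevant values outside `Ω`) that are annihilated by `L` as distributional sections. -/
def solutions (L : Cₛ^∞⟮𝓡 n; F, E⟯ →ₗ[ℝ] Cₛ^∞⟮𝓡 n; F', E'⟯) (Ω : Set M) : Set (∀ x, E x) :=
  {v | ∃ T : DistSection n F E Ω, IsGivenBy vol Ω T v ∧ applyDist vol L Ω T = 0}

end Operators

/-! ### Geometry -/

section Geometry

variable (n : ℕ) {M : Type*} [TopologicalSpace M] [ChartedSpace (EuclideanSpace ℝ (Fin n)) M]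

/-- The measure `vol` is given by a smooth positive density: in the preferred chart at every point,
it has a smooth positive density with respect to Lebesgue measure. -/
def IsSmoothPositiveDensity [MeasurableSpace M] (vol : Measure M) : Prop :=
  ∀ p : M, ∃ ρ : EuclideanSpace ℝ (Fin n) → ℝ,
    ContDiffOn ℝ ∞ ρ (chartAt (EuclideanSpace ℝ (Fin n)) p).target ∧
    (∀ y ∈ (chartAt (EuclideanSpace ℝ (Fin n)) p).target, 0 < ρ y) ∧
    ∀ A : Set M, MeasurableSet A → A ⊆ (chartAt (EuclideanSpace ℝ (Fin n)) p).source →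
      vol A = ∫⁻ y in chartAt (EuclideanSpace ℝ (Fin n)) p '' A, ENNReal.ofReal (ρ y)

/-- `S` is an embedded submanifold of codimension `m` (without boundary): around each of its points
there is a smooth chart of `M` in which `S` is a linear subspace of codimension `m`. -/
def IsEmbeddedSubmanifold (m : ℕ) (S : Set M) : Prop :=
  ∀ p ∈ S, ∃ c ∈ IsManifold.maximalAtlas (𝓡 n) ∞ M, p ∈ c.source ∧
    ∃ W : Submodule ℝ (EuclideanSpace ℝ (Fin n)), Module.finrank ℝ W + m = n ∧
      ∀ x ∈ c.source, x ∈ S ↔ c x ∈ W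

/-- The closed `r`-neighbourhood of `S` with `S` removed. -/
def puncturedNbhd {X : Type*} [PseudoEMetricSpace X] (S : Set X) (r : ℝ) : Set X :=
  {x | Metric.infEDist x S ≤ ENNReal.ofReal r} \ S

end Geometry

end DiffOp

end

/-! The decay hypothesis makes `u` locally integrable up to `S`, so integration over the complement
of `S` defines a distributional section `T` on all of `M` (`exists_distSection_setIntegral`). The
point is that `L T = 0` also across `S`. Weak hypoellipticity then makes `T` a smooth section, which
agrees with `u` off `S` by the fundamental lemma (`eqOn_of_forall_integral_eq`). Uniqueness holds
because the complement of a submanifold of positive codimension is dense.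

To see `L T = 0` near `p ∈ S`, take a smooth `η` defined in the chart at `p` that vanishes on `S`
and satisfies `d(x, S) ≤ C ‖η‖` (`IsEmbeddedSubmanifold.exists_defining_function`), and a cutoff `χ`
equal to `1` on the unit ball and to `0` outside the ball of radius `2`. For a test section `φ`
supported near `p`, put `φ_r = χ(η / r) φ`. The difference `φ - φ_r` is supported away from `S`,
where `u` solves the equation, so `T[L* φ] = T[L* φ_r]`. Since `L*` has order `k`, `|L* φ_r| ≤ B
r⁻ᵏ` (`exists_norm_localAdjoint_rescaled_le`), and `L* φ_r` lives where `d(x, S) ≤ 2 C r`. Hence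
`|T[L* φ]|` is at most a multiple of `r⁻ᵏ` times the integral of `|u|` over that neighbourhood,
which is `r⁻ᵏ o(rᵏ)` and tends to `0` (`exists_nhds_eval_formalDual_eq_zero`). A partition of unity
removes the restriction on the support of `φ`.

This needs `L*` concretely: in a chart it is obtained by transposing each `A_j Dʲ` through repeated
integration by parts (`adjIter`, `localAdjoint`); globally it is glued by a partition of unity and
determined by its integral identity (`isFormalDual_formalDual`, `formalDual_eq`). -/

noncomputable section

set_option linter.unusedSectionVars false

namespace DiffOp

/-! ### Transposes of iterated derivatives on a vector space -/

section Adjoint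

variable {V : Type*} [NormedAddCommGroup V] [NormedSpace ℝ V]
  {F : Type*} [NormedAddCommGroup F] [NormedSpace ℝ F]

/-- Coefficients, densities and local representatives are smooth only on a chart image. Multiplied
by a factor supported there they become smooth everywhere, and this criterion is how that is
checked. -/
theorem contDiff_of_tsupport {f : V → F} {m : ℕ∞ω}
    (h : ∀ x ∈ tsupport f, ContDiffAt ℝ m f x) : ContDiff ℝ m f := by
  rw [← contMDiff_iff_contDiff]
  exact contMDiff_of_tsupport fun x hx => (h x hx).contMDiffAt

theorem tsupport_pairing_subset {X : Type*} [TopologicalSpace X] (B : X → F →L[ℝ] ℝ) (w : X → F) :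
    tsupport (fun y => B y (w y)) ⊆ tsupport B :=
  closure_mono (fun y hy h0 => hy (by simp [h0]))

/-- The pointwise pairing of a compactly supported smooth field of functionals with a function that
is smooth near its support. -/
theorem contDiff_pairing {B : V → F →L[ℝ] ℝ} {w : V → F} {U : Set V} (hU : IsOpen U)
    (hB : ContDiff ℝ ∞ B) (hBU : tsupport B ⊆ U) (hw : ContDiffOn ℝ ∞ w U) :
    ContDiff ℝ ∞ (fun y => B y (w y)) := by
  refine contDiff_of_tsupport fun x hx => ?_
  have hx' : x ∈ tsupport B := tsupport_pairing_subset B w hx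
  exact hB.contDiffAt.clm_apply (hw.contDiffAt (hU.mem_nhds (hBU hx')))

theorem integrable_pairing [MeasurableSpace V] [BorelSpace V] {μ : Measure V}
    [IsFiniteMeasureOnCompacts μ] {B : V → F →L[ℝ] ℝ} {w : V → F} {U : Set V} (hU : IsOpen U)
    (hB : ContDiff ℝ ∞ B) (hBc : HasCompactSupport B) (hBU : tsupport B ⊆ U)
    (hw : ContDiffOn ℝ ∞ w U) : Integrable (fun y => B y (w y)) μ :=
  (contDiff_pairing hU hB hBU hw).continuous.integrable_of_hasCompactSupport
    (hBc.of_isClosed_subset (isClosed_tsupport _) (tsupport_pairing_subset B w))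

/-- The constant precedes `B` in the quantifiers. This uniformity is needed later, when `B` runs
through a family of cutoffs depending on `r`. -/
theorem exists_norm_iteratedFDeriv_clm_comp_le {D D' : Type*} [NormedAddCommGroup D]
    [NormedSpace ℝ D] [NormedAddCommGroup D'] [NormedSpace ℝ D'] (Λ : D →L[ℝ] D') :
    ∃ C : ℝ, 0 ≤ C ∧ ∀ B : V → D, ContDiff ℝ ∞ B → ∀ (l : ℕ) (y : V),
      ‖iteratedFDeriv ℝ l (fun y => Λ (B y)) y‖ ≤ C * ‖iteratedFDeriv ℝ l B y‖ :=
  ⟨‖Λ‖, norm_nonneg _, fun _ hB l _ => Λ.norm_iteratedFDeriv_comp_left (n := l) (N := ∞)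
    hB.contDiffAt (by exact_mod_cast le_top)⟩

section TransposeStep

variable {ι : Type*} [Fintype ι] {D D' : Type*} [NormedAddCommGroup D] [NormedSpace ℝ D]
  [NormedAddCommGroup D'] [NormedSpace ℝ D']

/-- The first order operator `B ↦ -∑_i L_i ∂_i B`, the transpose of `w ↦ ∑_i L_iᵗ ∂_i w`. -/
def transposeStep (e : ι → V) (L : ι → D →L[ℝ] D') (B : V → D) (y : V) : D' :=
  -∑ i, L i (fderiv ℝ B y (e i))

/-- `transposeStep` as a linear map applied to the derivative. -/
def transposeStepCLM (e : ι → V) (L : ι → D →L[ℝ] D') : (V →L[ℝ] D) →L[ℝ] D' :=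
  -∑ i, (L i) ∘L (ContinuousLinearMap.apply ℝ D (e i))

variable (e : ι → V) (L : ι → D →L[ℝ] D')

theorem transposeStep_eq (B : V → D) :
    transposeStep e L B = transposeStepCLM e L ∘ fderiv ℝ B := by
  ext y
  simp [transposeStep, transposeStepCLM]

variable {e L} in
theorem contDiff_transposeStep {B : V → D} (hB : ContDiff ℝ ∞ B) :
    ContDiff ℝ ∞ (transposeStep e L B) := by
  rw [transposeStep_eq]
  exact (transposeStepCLM e L).contDiff.comp (hB.fderiv_right (m := ∞) (by simp))

theorem tsupport_transposeStep_subset (B : V → D) :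
    tsupport (transposeStep e L B) ⊆ tsupport B := by
  rw [transposeStep_eq]
  exact (tsupport_comp_subset (map_zero _) _).trans (tsupport_fderiv_subset ℝ)

theorem exists_norm_iteratedFDeriv_transposeStep_le :
    ∃ C : ℝ, 0 ≤ C ∧ ∀ B : V → D, ContDiff ℝ ∞ B → ∀ (l : ℕ) (y : V),
      ‖iteratedFDeriv ℝ l (transposeStep e L B) y‖ ≤ C * ‖iteratedFDeriv ℝ (l + 1) B y‖ := by
  obtain ⟨C, hC, h⟩ := exists_norm_iteratedFDeriv_clm_comp_le (V := V) (D := V →L[ℝ] D)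
    (transposeStepCLM e L)
  refine ⟨C, hC, fun B hB l y => ?_⟩
  rw [transposeStep_eq, ← norm_iteratedFDeriv_fderiv]
  exact h _ (hB.fderiv_right (m := ∞) (by simp)) l y

/-- Integration by parts in each direction `e i`; there is no boundary term because `B` has compact
support. The hypothesis `hpq` moves the coefficient from `w` to `B`. Smoothness of `w` is needed
only on `U`, since all integrands vanish off the support of `B`. -/
theorem integral_transposeStep [FiniteDimensional ℝ V] [MeasurableSpace V] [BorelSpace V]
    {μ : Measure V} [μ.IsAddHaarMeasure] {X Y : Type*} [NormedAddCommGroup X] [NormedSpace ℝ X]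
    [NormedAddCommGroup Y] [NormedSpace ℝ Y] (p : D' →L[ℝ] X →L[ℝ] ℝ) (q : D →L[ℝ] Y →L[ℝ] ℝ)
    (R : ι → X →L[ℝ] Y) (hpq : ∀ i d x, p (L i d) x = q d (R i x)) {B : V → D} {w : V → X}
    {U : Set V} (hU : IsOpen U) (hB : ContDiff ℝ ∞ B) (hBc : HasCompactSupport B)
    (hBU : tsupport B ⊆ U) (hw : ContDiffOn ℝ ∞ w U) :
    ∫ y, q (B y) (∑ i, R i (fderiv ℝ w y (e i))) ∂μ = ∫ y, p (transposeStep e L B y) (w y) ∂μ := by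
  have hd (i : ι) : ContDiffOn ℝ ∞ (fun y => fderiv ℝ w y (e i)) U := fun y hy =>
    (((hw.contDiffAt (hU.mem_nhds hy)).fderiv_right (m := ∞) (by simp)).clm_apply
      contDiffAt_const).contDiffWithinAt
  have hCs (i : ι) : ContDiff ℝ ∞ (fun y => L i (B y)) := (L i).contDiff.comp hB
  have hCd (i : ι) (y : V) : fderiv ℝ (fun y => L i (B y)) y (e i) = L i (fderiv ℝ B y (e i)) := by
    have h := ((L i).hasFDerivAt.comp y (hB.differentiable (by simp) y).hasFDerivAt).fderiv
    exact congrArg (fun T : V →L[ℝ] D' => T (e i)) h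
  have hCf (i : ι) : ContDiff ℝ ∞ (fun y => L i (fderiv ℝ B y (e i))) :=
    (L i).contDiff.comp ((hB.fderiv_right (m := ∞) (by simp)).clm_apply contDiff_const)
  have hps {d : V → D'} (hd : ContDiff ℝ ∞ d) : ContDiff ℝ ∞ (fun y => p (d y)) :=
    p.contDiff.comp hd
  have hsub {d : V → D'} (h : ∀ y, y ∉ tsupport B → d y = 0) :
      tsupport (fun y => p (d y)) ⊆ tsupport B :=
    closure_minimal (fun y hy => by
      by_contra hc
      exact hy (by simp [h y hc])) (isClosed_tsupport _)
  have hs1 (i : ι) : tsupport (fun y => p (L i (B y))) ⊆ tsupport B :=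
    hsub fun y hy => by simp [image_eq_zero_of_notMem_tsupport hy]
  have hs2 (i : ι) : tsupport (fun y => p (L i (fderiv ℝ B y (e i)))) ⊆ tsupport B :=
    hsub fun y hy => by
      simp [image_eq_zero_of_notMem_tsupport fun h => hy (tsupport_fderiv_subset ℝ h)]
  have hc {d : V → X →L[ℝ] ℝ} (h : tsupport d ⊆ tsupport B) : HasCompactSupport d :=
    hBc.of_isClosed_subset (isClosed_tsupport _) h
  have h1 (i : ι) : Integrable (fun y => p (L i (B y)) (fderiv ℝ w y (e i))) μ :=
    integrable_pairing hU (hps (hCs i)) (hc (hs1 i)) ((hs1 i).trans hBU) (hd i)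
  have h2 (i : ι) : Integrable (fun y => p (L i (fderiv ℝ B y (e i))) (w y)) μ :=
    integrable_pairing hU (hps (hCf i)) (hc (hs2 i)) ((hs2 i).trans hBU) hw
  have h3 (i : ι) : Integrable (fun y => p (L i (B y)) (w y)) μ :=
    integrable_pairing hU (hps (hCs i)) (hc (hs1 i)) ((hs1 i).trans hBU) hw
  have hsB (i : ι) : tsupport (fun y => L i (B y)) ⊆ tsupport B :=
    tsupport_comp_subset (map_zero (L i)) _
  have key (i : ι) : ∫ y, p (L i (B y)) (fderiv ℝ w y (e i)) ∂μ =
      -∫ y, p (L i (fderiv ℝ B y (e i))) (w y) ∂μ := by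
    simp only [← hCd] at h2 ⊢
    exact integral_bilinear_fderiv_right_eq_neg_left_of_integrable (h2 i) (h1 i) (h3 i)
      (fun x _ => (hCs i).differentiable (by simp) x)
      (fun x hx => (hw.contDiffAt (hU.mem_nhds (hBU (hsB i hx)))).differentiableAt (by simp))
  calc ∫ y, q (B y) (∑ i, R i (fderiv ℝ w y (e i))) ∂μ
      = ∫ y, ∑ i, p (L i (B y)) (fderiv ℝ w y (e i)) ∂μ := by simp [hpq]
    _ = ∑ i, -∫ y, p (L i (fderiv ℝ B y (e i))) (w y) ∂μ := by
        rw [integral_finsetSum _ fun i _ => h1 i]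
        simp only [key]
    _ = ∫ y, p (transposeStep e L B y) (w y) ∂μ := by
        rw [Finset.sum_neg_distrib, ← integral_finsetSum _ fun i _ => h2 i, ← integral_neg]
        simp [transposeStep]

end TransposeStep

variable [FiniteDimensional ℝ V]

/-- The map `T ↦ e_i^* ⊗ T`. -/
def tensorCoord (V F : Type*) [NormedAddCommGroup V] [NormedSpace ℝ V] [FiniteDimensional ℝ V]
    [NormedAddCommGroup F] [NormedSpace ℝ F] (j : ℕ) (i : Fin (Module.finrank ℝ V)) :
    (V [×j]→L[ℝ] F) →L[ℝ] (V [×(j + 1)]→L[ℝ] F) :=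
  ((continuousMultilinearCurryLeftEquiv ℝ (fun _ : Fin (j + 1) => V) F).symm.toContinuousLinearEquiv
      : (V →L[ℝ] (V [×j]→L[ℝ] F)) →L[ℝ] (V [×(j + 1)]→L[ℝ] F)) ∘L
    (ContinuousLinearMap.smulRightL ℝ V (V [×j]→L[ℝ] F)
      (((Module.finBasis ℝ V).coord i).toContinuousLinearMap))

/-- Expanding the first argument in a basis exhibits the derivative of order `j + 1` as a first
order operator with constant coefficients applied to the derivative of order `j`, which is the form
that `integral_transposeStep` treats. -/
theorem iteratedFDeriv_succ_eq_sum_tensorCoord (j : ℕ) (w : V → F) (y : V) :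
    iteratedFDeriv ℝ (j + 1) w y = ∑ i, tensorCoord V F j i
      (fderiv ℝ (iteratedFDeriv ℝ j w) y (Module.finBasis ℝ V i)) := by
  ext v
  rw [iteratedFDeriv_succ_apply_left, sum_apply]
  conv_lhs => rw [← (Module.finBasis ℝ V).sum_repr (v 0)]
  simp only [map_sum, map_smul, sum_apply, smul_apply]
  refine Finset.sum_congr rfl fun i _ => ?_
  rfl

/-- The transpose of `tensorCoord`. -/
def tensorCoordDual (V F : Type*) [NormedAddCommGroup V] [NormedSpace ℝ V] [FiniteDimensional ℝ V]
    [NormedAddCommGroup F] [NormedSpace ℝ F] (j : ℕ) (i : Fin (Module.finrank ℝ V)) :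
    ((V [×(j + 1)]→L[ℝ] F) →L[ℝ] ℝ) →L[ℝ] ((V [×j]→L[ℝ] F) →L[ℝ] ℝ) :=
  (ContinuousLinearMap.compL ℝ (V [×j]→L[ℝ] F) (V [×(j + 1)]→L[ℝ] F) ℝ).flip (tensorCoord V F j i)

/-- The transpose of the last of `j + 1` differentiations. -/
def derivTranspose (j : ℕ) (B : V → (V [×(j + 1)]→L[ℝ] F) →L[ℝ] ℝ) : V → (V [×j]→L[ℝ] F) →L[ℝ] ℝ :=
  transposeStep (Module.finBasis ℝ V) (tensorCoordDual V F j) B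

theorem contDiff_derivTranspose {j : ℕ} {B : V → (V [×(j + 1)]→L[ℝ] F) →L[ℝ] ℝ}
    (hB : ContDiff ℝ ∞ B) : ContDiff ℝ ∞ (derivTranspose j B) :=
  contDiff_transposeStep hB

theorem tsupport_derivTranspose_subset (j : ℕ) (B : V → (V [×(j + 1)]→L[ℝ] F) →L[ℝ] ℝ) :
    tsupport (derivTranspose j B) ⊆ tsupport B :=
  tsupport_transposeStep_subset _ _ B

/-- The transpose of the identification of vectors with `0`-linear maps. -/
def curryFinZeroDual (V F : Type*) [NormedAddCommGroup V] [NormedSpace ℝ V]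
    [NormedAddCommGroup F] [NormedSpace ℝ F] :
    ((V [×0]→L[ℝ] F) →L[ℝ] ℝ) →L[ℝ] (F →L[ℝ] ℝ) :=
  (ContinuousLinearMap.compL ℝ F (V [×0]→L[ℝ] F) ℝ).flip
    ((continuousMultilinearCurryFin0 ℝ V F).symm.toContinuousLinearEquiv : F →L[ℝ] (V [×0]→L[ℝ] F))

/-- The transpose of `j`-fold differentiation. -/
def adjIter : (j : ℕ) → (V → (V [×j]→L[ℝ] F) →L[ℝ] ℝ) → V → F →L[ℝ] ℝ
  | 0, B, y => curryFinZeroDual V F (B y)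
  | j + 1, B, y => adjIter j (derivTranspose j B) y

theorem contDiff_adjIter {j : ℕ} {B : V → (V [×j]→L[ℝ] F) →L[ℝ] ℝ}
    (hB : ContDiff ℝ ∞ B) : ContDiff ℝ ∞ (adjIter j B) := by
  induction j with
  | zero => exact (curryFinZeroDual V F).contDiff.comp hB
  | succ j ih => exact ih (contDiff_derivTranspose hB)

theorem tsupport_adjIter_subset (j : ℕ) (B : V → (V [×j]→L[ℝ] F) →L[ℝ] ℝ) :
    tsupport (adjIter j B) ⊆ tsupport B := by
  induction j with
  | zero => exact closure_mono (fun y hy h0 => hy (by simp [adjIter, h0]))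
  | succ j ih => exact (ih _).trans (tsupport_derivTranspose_subset j B)

/-- Each transposed differentiation costs one derivative of `B`. The order `l` is kept general so
that the induction on `j` can pass from `l + j` to `l + j + 1`; only `l = 0` is used in the end. -/
theorem exists_norm_adjIter_le (V F : Type*) [NormedAddCommGroup V] [NormedSpace ℝ V]
    [FiniteDimensional ℝ V] [NormedAddCommGroup F] [NormedSpace ℝ F] (j : ℕ) :
    ∃ C : ℝ, 0 ≤ C ∧ ∀ B : V → (V [×j]→L[ℝ] F) →L[ℝ] ℝ, ContDiff ℝ ∞ B → ∀ (l : ℕ) (y : V),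
      ‖iteratedFDeriv ℝ l (adjIter j B) y‖ ≤ C * ‖iteratedFDeriv ℝ (l + j) B y‖ := by
  induction j with
  | zero =>
    obtain ⟨C, hC, h⟩ := exists_norm_iteratedFDeriv_clm_comp_le (V := V)
      (D := (V [×0]→L[ℝ] F) →L[ℝ] ℝ) (D' := F →L[ℝ] ℝ) (curryFinZeroDual V F)
    exact ⟨C, hC, fun B hB l y => h B hB l y⟩
  | succ j ih =>
    obtain ⟨C, hC, h⟩ := ih
    obtain ⟨C', hC', h'⟩ := exists_norm_iteratedFDeriv_transposeStep_le
      (D := (V [×(j + 1)]→L[ℝ] F) →L[ℝ] ℝ) (D' := (V [×j]→L[ℝ] F) →L[ℝ] ℝ)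
      (Module.finBasis ℝ V) (tensorCoordDual V F j)
    refine ⟨C * C', by positivity, fun B hB l y => ?_⟩
    refine (h _ (contDiff_derivTranspose hB) l y).trans ?_
    rw [mul_assoc]
    exact mul_le_mul_of_nonneg_left (h' B hB (l + j) y) hC

theorem integral_adjIter [MeasurableSpace V] [BorelSpace V]
    {μ : Measure V} [μ.IsAddHaarMeasure] {j : ℕ} {B : V → (V [×j]→L[ℝ] F) →L[ℝ] ℝ} {w : V → F}
    {U : Set V} (hU : IsOpen U) (hB : ContDiff ℝ ∞ B) (hBc : HasCompactSupport B)
    (hBU : tsupport B ⊆ U) (hw : ContDiffOn ℝ ∞ w U) :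
    ∫ y, B y (iteratedFDeriv ℝ j w y) ∂μ = ∫ y, adjIter j B y (w y) ∂μ := by
  induction j with
  | zero =>
    refine integral_congr_ae (.of_forall fun y => ?_)
    simp only [adjIter]
    congr 1
  | succ j ih =>
    have hd : ContDiffOn ℝ ∞ (iteratedFDeriv ℝ j w) U := fun y hy =>
      ((hw.contDiffAt (hU.mem_nhds hy)).iteratedFDeriv_right (m := ∞) (i := j)
        (by exact_mod_cast le_top)).contDiffWithinAt
    simp only [iteratedFDeriv_succ_eq_sum_tensorCoord]
    let p := ContinuousLinearMap.id ℝ ((V [×j]→L[ℝ] F) →L[ℝ] ℝ)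
    let q := ContinuousLinearMap.id ℝ ((V [×(j + 1)]→L[ℝ] F) →L[ℝ] ℝ)
    have hpq : ∀ i d x, p (tensorCoordDual V F j i d) x = q d (tensorCoord V F j i x) :=
      fun _ _ _ => rfl
    -- Integration by parts against the function `iteratedFDeriv ℝ j w`; it removes one
    -- differentiation, and the induction hypothesis handles the others.
    refine (integral_transposeStep (D := (V [×(j + 1)]→L[ℝ] F) →L[ℝ] ℝ)
      (D' := (V [×j]→L[ℝ] F) →L[ℝ] ℝ) (μ := μ) (Module.finBasis ℝ V) (tensorCoordDual V F j) p q
      (tensorCoord V F j) hpq hU hB hBc hBU hd).trans ?_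
    have hs := tsupport_derivTranspose_subset j B
    exact ih (contDiff_derivTranspose hB) (hBc.of_isClosed_subset (isClosed_tsupport _) hs)
      (hs.trans hBU)

end Adjoint

/-! ### Derivative bounds for rescaled cutoffs -/

section Cutoff

variable {V : Type*} [NormedAddCommGroup V] [NormedSpace ℝ V]
  {W : Type*} [NormedAddCommGroup W] [NormedSpace ℝ W]
  {G : Type*} [NormedAddCommGroup G] [NormedSpace ℝ G]

/-- The derivatives of order `≤ k` of a smooth function are uniformly bounded on compact sets. -/
theorem exists_norm_iteratedFDeriv_le {f : V → G} (hf : ContDiff ℝ ∞ f) (k : ℕ) {K : Set V}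
    (hK : IsCompact K) : ∃ C : ℝ, 1 ≤ C ∧ ∀ j ≤ k, ∀ y ∈ K, ‖iteratedFDeriv ℝ j f y‖ ≤ C := by
  induction k with
  | zero =>
    obtain ⟨C, hC⟩ := hK.exists_bound_of_continuousOn (f := iteratedFDeriv ℝ 0 f)
      (hf.continuous_iteratedFDeriv (by simp)).continuousOn
    refine ⟨max C 1, le_max_right _ _, fun j hj y hy => ?_⟩
    obtain rfl : j = 0 := by omega
    exact (hC y hy).trans (le_max_left _ _)
  | succ k ih =>
    obtain ⟨C, hC⟩ := hK.exists_bound_of_continuousOn (f := iteratedFDeriv ℝ (k + 1) f)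
      (hf.continuous_iteratedFDeriv (by exact_mod_cast le_top)).continuousOn
    obtain ⟨C', hC'1, hC'⟩ := ih
    refine ⟨max C C', hC'1.trans (le_max_right _ _), fun j hj y hy => ?_⟩
    rcases Nat.lt_or_ge k j with h | h
    · obtain rfl : j = k + 1 := by omega
      exact (hC y hy).trans (le_max_left _ _)
    · exact (hC' j h y hy).trans (le_max_right _ _)

/-- Derivatives of the rescaled function `χ(η / r)` times a fixed function grow at most like
`r⁻ʲ`. -/
theorem exists_norm_iteratedFDeriv_rescaled_smul_le {χ : W → ℝ} {η : V → W} {Φ : V → G}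
    (hχ : ContDiff ℝ ∞ χ) {C₀ : ℝ} (k : ℕ) (hχb : ∀ j ≤ k, ∀ z, ‖iteratedFDeriv ℝ j χ z‖ ≤ C₀)
    (hη : ContDiff ℝ ∞ η) (hΦ : ContDiff ℝ ∞ Φ) (hΦc : HasCompactSupport Φ) :
    ∃ C : ℝ, 0 ≤ C ∧ ∀ r : ℝ, 0 < r → r ≤ 1 → ∀ j ≤ k, ∀ y,
      ‖iteratedFDeriv ℝ j (fun z => χ (r⁻¹ • η z) • Φ z) y‖ ≤ C * (r⁻¹) ^ k := by
  obtain ⟨C₁, hC₁1, hC₁⟩ := exists_norm_iteratedFDeriv_le hη k hΦc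
  obtain ⟨C₂, hC₂1, hC₂⟩ := exists_norm_iteratedFDeriv_le hΦ k hΦc
  have hC₀ : 0 ≤ C₀ := (norm_nonneg _).trans (hχb 0 (by omega) 0)
  -- The factor `k! C₀ C₁ ^ k` comes from the Faà di Bruno estimate for `χ(η / r)`, and `2 ^ k`
  -- bounds the sum of the binomial coefficients in the Leibniz rule.
  refine ⟨2 ^ k * ((k.factorial * C₀ * C₁ ^ k) * C₂), by positivity, fun r hr hr1 j hj y => ?_⟩
  have hri : 1 ≤ r⁻¹ := (one_le_inv₀ hr).2 hr1
  by_cases hy : y ∈ tsupport Φ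
  swap
  · have h0 : (fun z => χ (r⁻¹ • η z) • Φ z) =ᶠ[𝓝 y] fun _ => 0 := by
      filter_upwards [notMem_tsupport_iff_eventuallyEq.1 hy] with z hz
      simp [hz]
    rw [(h0.iteratedFDeriv ℝ j).self_of_nhds]
    simp only [iteratedFDeriv_fun_zero, Pi.zero_apply, norm_zero]
    positivity
  have hηr : ContDiff ℝ ∞ (fun z => r⁻¹ • η z) := contDiff_const.smul hη
  have hcomp : ∀ i ≤ k, ‖iteratedFDeriv ℝ i (fun z => χ (r⁻¹ • η z)) y‖ ≤
      k.factorial * C₀ * (C₁ ^ k * (r⁻¹) ^ k) := by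
    intro i hi
    -- The composition estimate asks for the bound `(C₁ r⁻¹) ^ l` on the derivative of order `l ≥ 1`
    -- of `η / r`. The available bound `C₁ r⁻¹` suffices because `C₁` and `r⁻¹` are at least `1`;
    -- for the same reason exponents may be raised to `k` afterwards.
    have := norm_iteratedFDeriv_comp_le (n := i) (N := ∞) hχ hηr (by exact_mod_cast le_top) y
      (C := C₀) (D := C₁ * r⁻¹) (fun l hl => hχb l (hl.trans hi) _) (fun l hl1 hl => by
        rw [iteratedFDeriv_const_smul_apply' (hη.contDiffAt.of_le (by exact_mod_cast le_top)),
          norm_smul, mul_pow, Real.norm_of_nonneg (by positivity)]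
        rw [mul_comm]
        refine mul_le_mul ((hC₁ l (hl.trans hi) y hy).trans (le_self_pow₀ hC₁1 (by omega)))
          (le_self_pow₀ hri (by omega)) (by positivity) (by positivity))
    refine this.trans ?_
    rw [← mul_pow]
    have h1 : 1 ≤ C₁ * r⁻¹ := one_le_mul_of_one_le_of_one_le hC₁1 hri
    gcongr
  refine (norm_iteratedFDeriv_smul_le (N := ∞) (hχ.comp hηr) hΦ y
    (by exact_mod_cast le_top)).trans ?_
  calc ∑ i ∈ Finset.range (j + 1), (j.choose i : ℝ) *
        ‖iteratedFDeriv ℝ i (fun z => χ (r⁻¹ • η z)) y‖ * ‖iteratedFDeriv ℝ (j - i) Φ y‖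
      ≤ ∑ i ∈ Finset.range (j + 1), (j.choose i : ℝ) *
        (k.factorial * C₀ * (C₁ ^ k * (r⁻¹) ^ k)) * C₂ := by
        refine Finset.sum_le_sum fun i hi => ?_
        have hi' : i ≤ j := by simpa [Nat.lt_succ_iff] using hi
        have h1 := hcomp i (hi'.trans hj)
        have h2 := hC₂ (j - i) (by omega) y hy
        gcongr
    _ = 2 ^ j * ((k.factorial * C₀ * (C₁ ^ k * (r⁻¹) ^ k)) * C₂) := by
        rw [← Finset.sum_mul, ← Finset.sum_mul]
        have := Nat.sum_range_choose j
        have h : (∑ i ∈ Finset.range (j + 1), (j.choose i : ℝ)) = 2 ^ j := by exact_mod_cast this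
        rw [h]; ring
    _ ≤ 2 ^ k * ((k.factorial * C₀ * (C₁ ^ k * (r⁻¹) ^ k)) * C₂) := by
        gcongr
        norm_num
    _ = _ := by ring

end Cutoff

/-! ### Sections and their local representatives -/

section LocalSections

variable {n : ℕ} {M : Type*} [TopologicalSpace M] [ChartedSpace (EuclideanSpace ℝ (Fin n)) M]
  {F : Type*} [NormedAddCommGroup F] [NormedSpace ℝ F]
  {E : M → Type*} [∀ x, AddCommGroup (E x)] [∀ x, Module ℝ (E x)] [∀ x, TopologicalSpace (E x)]
  [TopologicalSpace (TotalSpace F E)] [FiberBundle F E]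

local notation "𝔼" => EuclideanSpace ℝ (Fin n)

variable (F E) in
theorem isOpen_patch (p : M) : IsOpen (patch (n := n) F E p) :=
  (chartAt 𝔼 p).open_source.inter (trivializationAt F E p).open_baseSet

variable (F E) in
theorem mem_patch (p : M) : p ∈ patch (n := n) F E p :=
  ⟨mem_chart_source _ p, mem_baseSet_trivializationAt F E p⟩

theorem isOpen_chart_image {p : M} {U : Set M} (hU : IsOpen U) (hUs : U ⊆ (chartAt 𝔼 p).source) :
    IsOpen (chartAt 𝔼 p '' U) :=
  (chartAt 𝔼 p).isOpen_image_of_subset_source hU hUs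

theorem chart_symm_mem {p : M} {U : Set M} (hUs : U ⊆ (chartAt 𝔼 p).source) {y : 𝔼}
    (hy : y ∈ chartAt 𝔼 p '' U) :
    (chartAt 𝔼 p).symm y ∈ U ∧ chartAt 𝔼 p ((chartAt 𝔼 p).symm y) = y := by
  obtain ⟨x, hx, rfl⟩ := hy
  rw [(chartAt 𝔼 p).left_inv (hUs hx)]
  exact ⟨hx, rfl⟩

theorem localRep_chart {p x : M} (hx : x ∈ (chartAt 𝔼 p).source) (v : ∀ x, E x) :
    localRep F E p v (chartAt 𝔼 p x) = (trivializationAt F E p ⟨x, v x⟩).2 := by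
  unfold localRep
  rw [(chartAt 𝔼 p).left_inv hx]

variable [VectorBundle ℝ F E]

theorem localRep_eq_zero {p : M} {v : ∀ x, E x} {y : 𝔼}
    (hy : (chartAt 𝔼 p).symm y ∈ (trivializationAt F E p).baseSet)
    (hv : v ((chartAt 𝔼 p).symm y) = 0) : localRep F E p v y = 0 := by
  unfold localRep
  rw [hv]
  exact congr_arg Prod.snd ((trivializationAt F E p).zeroSection ℝ hy)

theorem eq_of_trivialization_eq {p x : M} (hx : x ∈ (trivializationAt F E p).baseSet) {v w : E x}
    (h : (trivializationAt F E p ⟨x, v⟩).2 = (trivializationAt F E p ⟨x, w⟩).2) : v = w := by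
  rw [← (trivializationAt F E p).symm_apply_apply_mk hx v,
    ← (trivializationAt F E p).symm_apply_apply_mk hx w, h]

theorem contDiffOn_localRep [IsManifold (𝓡 n) ∞ M] [ContMDiffVectorBundle ∞ F E (𝓡 n)]
    {Ω : Set M} {v : ∀ x, E x} (hv : IsSmoothOn (n := n) F E Ω v) (p : M) {U : Set M}
    (hU : IsOpen U) (hUp : U ⊆ patch (n := n) F E p) (hUΩ : U ⊆ Ω) :
    ContDiffOn ℝ ∞ (localRep F E p v) (chartAt 𝔼 p '' U) := by
  have hUs : U ⊆ (chartAt 𝔼 p).source := fun x hx => (hUp hx).1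
  have h1 : ContMDiffOn (𝓡 n) 𝓘(ℝ, F) ∞ (fun x => (trivializationAt F E p ⟨x, v x⟩).2) U :=
    ((trivializationAt F E p).contMDiffOn_section_iff hU fun x hx => (hUp hx).2).1 (hv.mono hUΩ)
  have h2 : ContMDiffOn (𝓡 n) (𝓡 n) ∞ (chartAt 𝔼 p).symm (chartAt 𝔼 p '' U) :=
    contMDiffOn_chart_symm.mono (by
      rintro y ⟨x, hx, rfl⟩
      exact (chartAt 𝔼 p).map_source (hUs hx))
  exact contMDiffOn_iff_contDiffOn.1 (h1.comp h2 fun y hy => (chart_symm_mem hUs hy).1)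

variable (E) in
open Classical in
/-- The section of `E`, supported in the chart domain at `p`, with local representative `f`. -/
def sectionOfLocal (p : M) (f : 𝔼 → F) (x : M) : E x :=
  if x ∈ (chartAt 𝔼 p).source then (trivializationAt F E p).symmₗ ℝ x (f (chartAt 𝔼 p x))
  else 0

theorem trivialization_sectionOfLocal {p x : M} (f : 𝔼 → F) (hx : x ∈ patch (n := n) F E p) :
    (trivializationAt F E p ⟨x, sectionOfLocal E p f x⟩).2 = f (chartAt 𝔼 p x) := by
  unfold sectionOfLocal
  rw [if_pos hx.1, Trivialization.symmₗ_apply _ hx.2,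
    (trivializationAt F E p).apply_mk_symm hx.2]

theorem localRep_sectionOfLocal {p : M} (f : 𝔼 → F) {y : 𝔼}
    (hy : y ∈ chartAt 𝔼 p '' patch (n := n) F E p) :
    localRep F E p (sectionOfLocal E p f) y = f y := by
  obtain ⟨x, hx, rfl⟩ := hy
  rw [localRep_chart hx.1, trivialization_sectionOfLocal f hx]

theorem sectionOfLocal_eq_zero {p x : M} {f : 𝔼 → F}
    (h : x ∈ (chartAt 𝔼 p).source → f (chartAt 𝔼 p x) = 0) : sectionOfLocal E p f x = 0 := by
  unfold sectionOfLocal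
  split_ifs with hx
  · rw [h hx, map_zero]
  · rfl

theorem isCompact_chart_symm_image {p : M} {f : 𝔼 → F} (hf : HasCompactSupport f)
    {U : Set M} (hU : U ⊆ (chartAt 𝔼 p).source) (hfU : tsupport f ⊆ chartAt 𝔼 p '' U) :
    IsCompact ((chartAt 𝔼 p).symm '' tsupport f) := by
  refine hf.isCompact.image_of_continuousOn ((chartAt 𝔼 p).continuousOn_symm.mono ?_)
  intro y hy
  obtain ⟨x, hx, rfl⟩ := hfU hy
  exact (chartAt 𝔼 p).map_source (hU hx)

theorem sectionSupport_sectionOfLocal_subset [T2Space M] {p : M} {f : 𝔼 → F}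
    (hf : HasCompactSupport f) {U : Set M} (hU : U ⊆ (chartAt 𝔼 p).source)
    (hfU : tsupport f ⊆ chartAt 𝔼 p '' U) :
    sectionSupport (sectionOfLocal E p f) ⊆ (chartAt 𝔼 p).symm '' tsupport f := by
  refine closure_minimal (fun x hx => ?_) (isCompact_chart_symm_image hf hU hfU).isClosed
  by_contra hc
  refine hx (sectionOfLocal_eq_zero fun hxs => ?_)
  by_contra h0
  exact hc ⟨chartAt 𝔼 p x, subset_tsupport f h0, (chartAt 𝔼 p).left_inv hxs⟩

theorem notMem_sectionSupport_iff {v : ∀ x, E x} {x : M} :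
    x ∉ sectionSupport v ↔ ∀ᶠ z in 𝓝 x, v z = 0 := by
  unfold sectionSupport
  rw [mem_closure_iff_frequently, not_frequently]
  simp

theorem eq_zero_of_notMem_sectionSupport {v : ∀ x, E x} {x : M} (h : x ∉ sectionSupport v) :
    v x = 0 := by
  by_contra h0
  exact h (subset_closure h0)

/-- Off its closed support a section agrees locally with the zero section, so smoothness is only in
question on the support. -/
theorem contMDiff_of_sectionSupport {v : ∀ x, E x}
    (h : ∀ x ∈ sectionSupport v, ContMDiffAt (𝓡 n) ((𝓡 n).prod 𝓘(ℝ, F)) ∞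
      (fun x => TotalSpace.mk' F x (v x)) x) :
    ContMDiff (𝓡 n) ((𝓡 n).prod 𝓘(ℝ, F)) ∞ (fun x => TotalSpace.mk' F x (v x)) := by
  intro x
  by_cases hx : x ∈ sectionSupport v
  · exact h x hx
  · refine ((contMDiff_zeroSection ℝ E).contMDiffAt (x := x)).congr_of_eventuallyEq ?_
    filter_upwards [notMem_sectionSupport_iff.1 hx] with z hz
    rw [hz]
    rfl

theorem contMDiff_sectionOfLocal [T2Space M] [IsManifold (𝓡 n) ∞ M]
    [ContMDiffVectorBundle ∞ F E (𝓡 n)] {p : M} {f : 𝔼 → F} (hfs : ContDiff ℝ ∞ f)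
    (hf : HasCompactSupport f) (hfU : tsupport f ⊆ chartAt 𝔼 p '' patch (n := n) F E p) :
    ContMDiff (𝓡 n) ((𝓡 n).prod 𝓘(ℝ, F)) ∞
      (fun x => TotalSpace.mk' F x (sectionOfLocal E p f x)) := by
  refine contMDiff_of_sectionSupport fun x hx => ?_
  have hxp : x ∈ patch (n := n) F E p := by
    obtain ⟨y, hy, rfl⟩ :=
      sectionSupport_sectionOfLocal_subset hf (fun x hx => hx.1) hfU hx
    exact (chart_symm_mem (fun x hx => hx.1) (hfU hy)).1
  rw [(trivializationAt F E p).contMDiffAt_section_iff hxp.2]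
  have h1 : ContMDiffAt (𝓡 n) 𝓘(ℝ, F) ∞ (fun x => f (chartAt 𝔼 p x)) x :=
    hfs.contMDiff.contMDiffAt.comp x
      (contMDiffAt_of_mem_maximalAtlas (IsManifold.chart_mem_maximalAtlas p) hxp.1)
  refine h1.congr_of_eventuallyEq ?_
  filter_upwards [(isOpen_patch F E p).mem_nhds hxp] with z hz
  exact trivialization_sectionOfLocal f hz

/-- The test section with a given compactly supported local representative. -/
def testSectionOfLocal [T2Space M] [IsManifold (𝓡 n) ∞ M]
    [ContMDiffVectorBundle ∞ F E (𝓡 n)] (p : M) (f : 𝔼 → F) (hfs : ContDiff ℝ ∞ f)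
    (hf : HasCompactSupport f) (hfU : tsupport f ⊆ chartAt 𝔼 p '' patch (n := n) F E p)
    {Ω : Set M} (hΩ : (chartAt 𝔼 p).symm '' tsupport f ⊆ Ω) : testSections (n := n) F E Ω :=
  ⟨⟨sectionOfLocal E p f, contMDiff_sectionOfLocal hfs hf hfU⟩,
    (isCompact_chart_symm_image hf (fun _ hx => hx.1) hfU).of_isClosed_subset isClosed_closure
      (sectionSupport_sectionOfLocal_subset hf (fun _ hx => hx.1) hfU),
    (sectionSupport_sectionOfLocal_subset hf (fun _ hx => hx.1) hfU).trans hΩ⟩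

end LocalSections

/-! ### The dual pairing in coordinates -/

section Pairing

variable {n : ℕ} {M : Type*} [TopologicalSpace M] [ChartedSpace (EuclideanSpace ℝ (Fin n)) M]
  {F : Type*} [NormedAddCommGroup F] [NormedSpace ℝ F]
  {E : M → Type*} [∀ x, AddCommGroup (E x)] [∀ x, Module ℝ (E x)] [∀ x, TopologicalSpace (E x)]
  [TopologicalSpace (TotalSpace F E)] [FiberBundle F E] [VectorBundle ℝ F E]

local notation "𝔼" => EuclideanSpace ℝ (Fin n)

theorem patch_dual (p : M) : patch (n := n) (F →L[ℝ] ℝ) (Dual E) p = patch (n := n) F E p := by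
  unfold patch
  rw [hom_trivializationAt_baseSet]
  simp

/-- The trivialization of the dual bundle is contragredient to that of `E`, so the pairing does not
change on passing to coordinates. This allows the integrals to be computed in charts. -/
theorem trivialization_dual_apply {p x : M} (hx : x ∈ (trivializationAt F E p).baseSet)
    (φ : Dual E x) (v : E x) :
    (trivializationAt (F →L[ℝ] ℝ) (Dual E) p ⟨x, φ⟩).2 (trivializationAt F E p ⟨x, v⟩).2 = φ v := by
  rw [hom_trivializationAt_apply]
  simp only [ContinuousLinearMap.inCoordinates, ContinuousLinearMap.comp_apply]
  rw [Trivialization.symmL_apply _ hx, (trivializationAt F E p).symm_apply_apply_mk hx]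
  simp

theorem localRep_dual_apply {p x : M} (hx : x ∈ patch (n := n) F E p)
    (φ : ∀ x, Dual E x) (v : ∀ x, E x) :
    localRep (F →L[ℝ] ℝ) (Dual E) p φ (chartAt 𝔼 p x) (localRep F E p v (chartAt 𝔼 p x)) =
      φ x (v x) := by
  rw [localRep_chart hx.1, localRep_chart hx.1, trivialization_dual_apply hx.2]

end Pairing

/-! ### Smooth positive densities and change of variables -/

section Density

variable {n : ℕ} {M : Type*} [TopologicalSpace M] [ChartedSpace (EuclideanSpace ℝ (Fin n)) M]
  [MeasurableSpace M] [BorelSpace M] {vol : Measure M}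

local notation "𝔼" => EuclideanSpace ℝ (Fin n)

/-- In a chart, the measure is the Lebesgue measure times the density. -/
theorem restrict_chart_source_eq {p : M} {ρ : 𝔼 → ℝ}
    (h : ∀ A : Set M, MeasurableSet A → A ⊆ (chartAt 𝔼 p).source →
      vol A = ∫⁻ y in chartAt 𝔼 p '' A, ENNReal.ofReal (ρ y)) :
    vol.restrict (chartAt 𝔼 p).source =
      ((volume.restrict (chartAt 𝔼 p).target).withDensity fun y => ENNReal.ofReal (ρ y)).map
        (chartAt 𝔼 p).symm := by
  set c := chartAt 𝔼 p
  have hm : AEMeasurable c.symm (volume.restrict c.target) :=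
    c.continuousOn_symm.aemeasurable c.open_target.measurableSet
  have hm' : AEMeasurable c.symm
      ((volume.restrict c.target).withDensity fun y => ENNReal.ofReal (ρ y)) :=
    hm.mono_ac (withDensity_absolutelyContinuous _ _)
  ext A hA
  have hAs : MeasurableSet (A ∩ c.source) := hA.inter c.open_source.measurableSet
  rw [Measure.restrict_apply hA, Measure.map_apply_of_aemeasurable hm' hA,
    h _ hAs inter_subset_right]
  have him : c '' (A ∩ c.source) = c.symm ⁻¹' A ∩ c.target := by
    ext y
    constructor
    · rintro ⟨x, ⟨hxA, hxs⟩, rfl⟩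
      exact ⟨by simpa [c.left_inv hxs] using hxA, c.map_source hxs⟩
    · rintro ⟨hyA, hyt⟩
      exact ⟨c.symm y, ⟨hyA, c.map_target hyt⟩, c.right_inv hyt⟩
  -- Since `c.symm` is continuous only on the target, this preimage is handled as a null measurable
  -- set for the restricted measure.
  have hN : NullMeasurableSet (c.symm ⁻¹' A) (volume.restrict c.target) := hm.nullMeasurable hA
  rw [him, withDensity_apply₀ _ (hN.mono_ac (Measure.AbsolutelyContinuous.refl _)),
    Measure.restrict_restrict₀ hN]

/-- Change of variables: integration of a function supported in a chart domain. -/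
theorem integral_eq_integral_chart {p : M} {ρ : 𝔼 → ℝ}
    (hρ : ContDiffOn ℝ ∞ ρ (chartAt 𝔼 p).target) (hpos : ∀ y ∈ (chartAt 𝔼 p).target, 0 < ρ y)
    (h : ∀ A : Set M, MeasurableSet A → A ⊆ (chartAt 𝔼 p).source →
      vol A = ∫⁻ y in chartAt 𝔼 p '' A, ENNReal.ofReal (ρ y))
    {g : M → ℝ} (hg : AEStronglyMeasurable g (vol.restrict (chartAt 𝔼 p).source))
    {U : Set M} (hUs : U ⊆ (chartAt 𝔼 p).source) (hgU : ∀ x ∉ U, g x = 0)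
    {f : 𝔼 → ℝ} (hf : ∀ x ∈ U, f (chartAt 𝔼 p x) = ρ (chartAt 𝔼 p x) * g x)
    (hfU : ∀ y ∉ chartAt 𝔼 p '' U, f y = 0) :
    ∫ x, g x ∂vol = ∫ y, f y := by
  set c := chartAt 𝔼 p
  have h1 : ∫ x, g x ∂vol = ∫ x in c.source, g x ∂vol :=
    (setIntegral_eq_integral_of_forall_compl_eq_zero fun x hx => hgU x fun hxU => hx (hUs hxU)).symm
  have h2 : ∫ y, f y = ∫ y in c.target, f y := by
    refine (setIntegral_eq_integral_of_forall_compl_eq_zero fun y hy => hfU y fun hyU => hy ?_).symm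
    obtain ⟨x, hx, rfl⟩ := hyU
    exact c.map_source (hUs hx)
  have hm : AEMeasurable c.symm (volume.restrict c.target) :=
    c.continuousOn_symm.aemeasurable c.open_target.measurableSet
  have hm' : AEMeasurable c.symm
      ((volume.restrict c.target).withDensity fun y => ENNReal.ofReal (ρ y)) :=
    hm.mono_ac (withDensity_absolutelyContinuous _ _)
  have hρm : AEMeasurable (fun y => ENNReal.ofReal (ρ y)) (volume.restrict c.target) :=
    (hρ.continuousOn.aemeasurable c.open_target.measurableSet).ennreal_ofReal
  rw [h1, h2]
  rw [restrict_chart_source_eq h] at hg ⊢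
  rw [integral_map hm' hg, integral_withDensity_eq_integral_toReal_smul₀ hρm
    (.of_forall fun _ => ENNReal.ofReal_lt_top)]
  refine setIntegral_congr_fun c.open_target.measurableSet fun y hy => ?_
  simp only [smul_eq_mul, ENNReal.toReal_ofReal (hpos y hy).le]
  -- Outside the image of `U` both integrands vanish, so `f` and `g` need to correspond only on `U`.
  by_cases hyU : c.symm y ∈ U
  · have := hf _ hyU
    rw [c.right_inv hy] at this
    exact this.symm
  · rw [hgU _ hyU, mul_zero, hfU]
    rintro ⟨x, hx, rfl⟩
    exact hyU (by rwa [c.left_inv (hUs hx)])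

/-- The density is continuous, hence integrable on a small closed ball inside the chart target. -/
theorem IsSmoothPositiveDensity.isLocallyFiniteMeasure (hvol : IsSmoothPositiveDensity n vol) :
    IsLocallyFiniteMeasure vol := by
  refine ⟨fun p => ?_⟩
  obtain ⟨ρ, hρ, hpos, h⟩ := hvol p
  set c := chartAt 𝔼 p
  have hpt : c p ∈ c.target := mem_chart_target 𝔼 p
  obtain ⟨δ, hδ, hball⟩ := Metric.nhds_basis_closedBall.mem_iff.1 (c.open_target.mem_nhds hpt)
  have himg : c '' (c.source ∩ c ⁻¹' Metric.ball (c p) δ) = Metric.ball (c p) δ := by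
    ext y
    constructor
    · rintro ⟨x, hx, rfl⟩
      exact hx.2
    · intro hy
      have hyt := hball (Metric.ball_subset_closedBall hy)
      exact ⟨c.symm y, ⟨c.map_target hyt, by simpa [c.right_inv hyt] using hy⟩, c.right_inv hyt⟩
  have hopen : IsOpen (c.source ∩ c ⁻¹' Metric.ball (c p) δ) :=
    c.isOpen_inter_preimage Metric.isOpen_ball
  refine ⟨_, hopen.mem_nhds ⟨mem_chart_source 𝔼 p, Metric.mem_ball_self hδ⟩, ?_⟩
  rw [h _ hopen.measurableSet inter_subset_left, himg]
  have hint : IntegrableOn ρ (Metric.closedBall (c p) δ) :=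
    (hρ.continuousOn.mono hball).integrableOn_compact (isCompact_closedBall _ _)
  refine lt_of_le_of_lt ?_ (hint.mono_set Metric.ball_subset_closedBall).2
  exact lintegral_mono fun y => Real.ofReal_le_enorm _

/-- As the density is positive, a null open set would have a Lebesgue null open image in a chart,
which must then be empty. -/
theorem IsSmoothPositiveDensity.isOpenPosMeasure (hvol : IsSmoothPositiveDensity n vol) :
    vol.IsOpenPosMeasure := by
  refine ⟨fun U hU ⟨p, hp⟩ h0 => ?_⟩
  obtain ⟨ρ, hρ, hpos, h⟩ := hvol p
  set c := chartAt 𝔼 p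
  have hopen : IsOpen (U ∩ c.source) := hU.inter c.open_source
  have h1 : vol (U ∩ c.source) = 0 := measure_mono_null inter_subset_left h0
  have himg : IsOpen (c '' (U ∩ c.source)) := isOpen_chart_image hopen inter_subset_right
  have himgt : c '' (U ∩ c.source) ⊆ c.target := by
    rintro _ ⟨x, hx, rfl⟩
    exact c.map_source hx.2
  have hρm : AEMeasurable (fun y => ENNReal.ofReal (ρ y)) (volume.restrict (c '' (U ∩ c.source))) :=
    ((hρ.continuousOn.mono himgt).aemeasurable himg.measurableSet).ennreal_ofReal
  rw [h _ hopen.measurableSet inter_subset_right, lintegral_eq_zero_iff' hρm] at h1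
  have h2 : ∀ᵐ y ∂(volume.restrict (c '' (U ∩ c.source))), False := by
    filter_upwards [h1, ae_restrict_mem himg.measurableSet] with y hy hyU
    have := hpos y (himgt hyU)
    simp only [Pi.zero_apply, ENNReal.ofReal_eq_zero] at hy
    linarith
  have h3 : volume (c '' (U ∩ c.source)) = 0 := by
    rw [ae_iff] at h2
    simpa using h2
  exact (himg.measure_pos volume ⟨c p, p, ⟨hp, mem_chart_source 𝔼 p⟩, rfl⟩).ne' h3

end Density

/-! ### The formal adjoint of a differential operator in a chart -/

section LocalAdjoint

variable {V : Type*} [NormedAddCommGroup V] [NormedSpace ℝ V] [FiniteDimensional ℝ V]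
  {F : Type*} [NormedAddCommGroup F] [NormedSpace ℝ F]
  {F' : Type*} [NormedAddCommGroup F'] [NormedSpace ℝ F']

/-- The functional `T ↦ ρ ⟨f, A T⟩`. -/
def weightedFunctional {X : Type*} [NormedAddCommGroup X] [NormedSpace ℝ X] (ρ : V → ℝ)
    (A : V → X →L[ℝ] F') (f : V → F' →L[ℝ] ℝ) (y : V) : X →L[ℝ] ℝ :=
  ρ y • (f y ∘L A y)

theorem tsupport_weightedFunctional_subset {X : Type*} [NormedAddCommGroup X] [NormedSpace ℝ X]
    (ρ : V → ℝ) (A : V → X →L[ℝ] F') (f : V → F' →L[ℝ] ℝ) :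
    tsupport (weightedFunctional ρ A f) ⊆ tsupport f :=
  closure_mono fun y hy h0 => hy (by simp [weightedFunctional, h0])

theorem contDiff_weightedFunctional {X : Type*} [NormedAddCommGroup X] [NormedSpace ℝ X]
    {ρ : V → ℝ} {A : V → X →L[ℝ] F'} {f : V → F' →L[ℝ] ℝ} {U : Set V} (hU : IsOpen U)
    (hρ : ContDiffOn ℝ ∞ ρ U) (hA : ContDiffOn ℝ ∞ A U) (hf : ContDiff ℝ ∞ f)
    (hfU : tsupport f ⊆ U) : ContDiff ℝ ∞ (weightedFunctional ρ A f) := by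
  refine contDiff_of_tsupport fun y hy => ?_
  have hyU := hU.mem_nhds (hfU (tsupport_weightedFunctional_subset ρ A f hy))
  exact (hρ.contDiffAt hyU).smul (hf.contDiffAt.clm_comp (hA.contDiffAt hyU))

/-- The formal adjoint, with respect to the density `ρ`, of the differential operator
`∑_{j ≤ k} A_j D^j`. -/
def localAdjoint (k : ℕ) (ρ : V → ℝ) (A : ∀ j : ℕ, V → (V [×j]→L[ℝ] F) →L[ℝ] F')
    (f : V → F' →L[ℝ] ℝ) (y : V) : F →L[ℝ] ℝ :=
  (ρ y)⁻¹ • ∑ j ∈ Finset.range (k + 1), adjIter j (weightedFunctional ρ (A j) f) y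

variable {k : ℕ} {ρ : V → ℝ} {A : ∀ j : ℕ, V → (V [×j]→L[ℝ] F) →L[ℝ] F'} {f : V → F' →L[ℝ] ℝ}
  {U : Set V}

theorem adjIter_weightedFunctional_eq_zero (j : ℕ) {y : V} (hy : y ∉ tsupport f) :
    adjIter j (weightedFunctional ρ (A j) f) y = 0 := by
  have hs : tsupport (adjIter j (weightedFunctional ρ (A j) f)) ⊆ tsupport f :=
    (tsupport_adjIter_subset j (weightedFunctional ρ (A j) f)).trans
      (tsupport_weightedFunctional_subset ρ (A j) f)
  exact image_eq_zero_of_notMem_tsupport fun h => hy (hs h)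

variable (k ρ A f) in
theorem tsupport_localAdjoint_subset : tsupport (localAdjoint k ρ A f) ⊆ tsupport f :=
  closure_minimal (fun y hy => by
    by_contra hc
    refine hy ?_
    unfold localAdjoint
    rw [Finset.sum_eq_zero fun j _ => adjIter_weightedFunctional_eq_zero j hc, smul_zero])
    (isClosed_tsupport _)

theorem contDiff_localAdjoint (hU : IsOpen U)
    (hρ : ContDiffOn ℝ ∞ ρ U) (hpos : ∀ y ∈ U, 0 < ρ y) (hA : ∀ j ≤ k, ContDiffOn ℝ ∞ (A j) U)
    (hf : ContDiff ℝ ∞ f) (hfU : tsupport f ⊆ U) : ContDiff ℝ ∞ (localAdjoint k ρ A f) := by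
  refine contDiff_of_tsupport fun y hy => ?_
  have hyU := hfU (tsupport_localAdjoint_subset k ρ A f hy)
  refine ((hρ.contDiffAt (hU.mem_nhds hyU)).inv (hpos y hyU).ne').smul ?_
  refine ContDiffAt.sum fun j hj => ?_
  have hj' : j ≤ k := by simpa [Nat.lt_succ_iff] using hj
  exact (contDiff_adjIter (contDiff_weightedFunctional hU hρ (hA j hj') hf hfU)).contDiffAt

/-- Each order `j` is integrated by parts separately, with `ρ` absorbed into the functional paired
with the derivative. On the support of `f` the factor `ρ⁻¹` in `localAdjoint` cancels the weight;
off it both integrands vanish. -/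
theorem integral_localAdjoint [MeasurableSpace V] [BorelSpace V] {μ : Measure V}
    [μ.IsAddHaarMeasure] (hU : IsOpen U)
    (hρ : ContDiffOn ℝ ∞ ρ U) (hpos : ∀ y ∈ U, 0 < ρ y) (hA : ∀ j ≤ k, ContDiffOn ℝ ∞ (A j) U)
    (hf : ContDiff ℝ ∞ f) (hfc : HasCompactSupport f) (hfU : tsupport f ⊆ U) {w : V → F}
    (hw : ContDiffOn ℝ ∞ w U) :
    ∫ y, ρ y * f y (∑ j ∈ Finset.range (k + 1), A j y (iteratedFDeriv ℝ j w y)) ∂μ =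
      ∫ y, ρ y * localAdjoint k ρ A f y (w y) ∂μ := by
  set B := fun j => weightedFunctional ρ (A j) f with hB
  have hj {j : ℕ} (hj : j ∈ Finset.range (k + 1)) : j ≤ k := by simpa [Nat.lt_succ_iff] using hj
  have hBs (j) (h : j ∈ Finset.range (k + 1)) : ContDiff ℝ ∞ (B j) :=
    contDiff_weightedFunctional hU hρ (hA j (hj h)) hf hfU
  have hBt (j) : tsupport (B j) ⊆ tsupport f := tsupport_weightedFunctional_subset _ _ _
  have hBc (j) : HasCompactSupport (B j) := hfc.of_isClosed_subset (isClosed_tsupport _) (hBt j)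
  have hd (j : ℕ) : ContDiffOn ℝ ∞ (iteratedFDeriv ℝ j w) U := fun y hy =>
    ((hw.contDiffAt (hU.mem_nhds hy)).iteratedFDeriv_right (m := ∞) (i := j)
      (by exact_mod_cast le_top)).contDiffWithinAt
  have hAt (j) : tsupport (adjIter j (B j)) ⊆ tsupport f :=
    (tsupport_adjIter_subset _ _).trans (hBt j)
  calc ∫ y, ρ y * f y (∑ j ∈ Finset.range (k + 1), A j y (iteratedFDeriv ℝ j w y)) ∂μ
      = ∫ y, ∑ j ∈ Finset.range (k + 1), B j y (iteratedFDeriv ℝ j w y) ∂μ := by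
        refine integral_congr_ae (.of_forall fun y => ?_)
        simp only [map_sum, Finset.mul_sum, hB]
        rfl
    _ = ∑ j ∈ Finset.range (k + 1), ∫ y, adjIter j (B j) y (w y) ∂μ := by
        rw [integral_finsetSum _ fun j h =>
          integrable_pairing hU (hBs j h) (hBc j) ((hBt j).trans hfU) (hd j)]
        exact Finset.sum_congr rfl fun j h =>
          integral_adjIter hU (hBs j h) (hBc j) ((hBt j).trans hfU) hw
    _ = ∫ y, ∑ j ∈ Finset.range (k + 1), adjIter j (B j) y (w y) ∂μ :=
        (integral_finsetSum _ fun j h => integrable_pairing hU (contDiff_adjIter (hBs j h))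
          (hfc.of_isClosed_subset (isClosed_tsupport _) (hAt j)) ((hAt j).trans hfU) hw).symm
    _ = ∫ y, ρ y * localAdjoint k ρ A f y (w y) ∂μ := by
        refine integral_congr_ae (.of_forall fun y => ?_)
        by_cases hy : y ∈ tsupport f
        · simp [localAdjoint, mul_inv_cancel_left₀ (hpos y (hfU hy)).ne', hB]
        · have h0 : localAdjoint k ρ A f y = 0 :=
            image_eq_zero_of_notMem_tsupport fun h => hy (tsupport_localAdjoint_subset k ρ A f h)
          have h1 (j) : adjIter j (B j) y = 0 := adjIter_weightedFunctional_eq_zero j hy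
          simp [h0, h1]

/-- Rescaled cutoffs: the formal adjoint applied to `χ(η / r) f` is bounded by a multiple of
`r⁻ᵏ`. -/
theorem exists_norm_localAdjoint_rescaled_le {W : Type*} [NormedAddCommGroup W] [NormedSpace ℝ W]
    (hU : IsOpen U) (hρ : ContDiffOn ℝ ∞ ρ U) (hpos : ∀ y ∈ U, 0 < ρ y)
    (hA : ∀ j ≤ k, ContDiffOn ℝ ∞ (A j) U) (hf : ContDiff ℝ ∞ f) (hfc : HasCompactSupport f)
    (hfU : tsupport f ⊆ U) {χ : W → ℝ} {η : V → W} (hχ : ContDiff ℝ ∞ χ) {C₀ : ℝ}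
    (hχb : ∀ j ≤ k, ∀ z, ‖iteratedFDeriv ℝ j χ z‖ ≤ C₀) (hη : ContDiff ℝ ∞ η) :
    ∃ C : ℝ, 0 ≤ C ∧ ∀ r : ℝ, 0 < r → r ≤ 1 → ∀ y,
      ‖localAdjoint k ρ A (fun z => χ (r⁻¹ • η z) • f z) y‖ ≤ C * (r⁻¹) ^ k := by
  obtain ⟨C₁, hC₁⟩ := hfc.isCompact.exists_bound_of_continuousOn (f := fun y => (ρ y)⁻¹)
    ((hρ.continuousOn.mono hfU).inv₀ fun y hy => (hpos y (hfU hy)).ne')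
  have key (j : ℕ) : ∃ C : ℝ, 0 ≤ C ∧ (j ≤ k → ∀ r : ℝ, 0 < r → r ≤ 1 → ∀ y,
      ‖adjIter j (weightedFunctional ρ (A j) (fun z => χ (r⁻¹ • η z) • f z)) y‖ ≤
        C * (r⁻¹) ^ k) := by
    by_cases hjk : j ≤ k
    swap
    · exact ⟨0, le_rfl, fun h => absurd h hjk⟩
    obtain ⟨C₂, hC₂0, hC₂⟩ := exists_norm_adjIter_le V F j
    have hBs := contDiff_weightedFunctional hU hρ (hA j hjk) hf hfU
    obtain ⟨C₃, hC₃0, hC₃⟩ := exists_norm_iteratedFDeriv_rescaled_smul_le hχ k hχb hη hBs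
      (hfc.of_isClosed_subset (isClosed_tsupport _) (tsupport_weightedFunctional_subset _ _ _))
    refine ⟨C₂ * C₃, by positivity, fun _ r hr hr1 y => ?_⟩
    -- The cutoff is a scalar factor and can be pulled out, leaving a field that does not depend on
    -- `r`, to which the rescaling estimate applies.
    have heq : weightedFunctional ρ (A j) (fun z => χ (r⁻¹ • η z) • f z) =
        fun z => χ (r⁻¹ • η z) • weightedFunctional ρ (A j) f z := by
      ext z T
      simp [weightedFunctional]
      ring
    have hs : ContDiff ℝ ∞ (fun z => χ (r⁻¹ • η z) • weightedFunctional ρ (A j) f z) :=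
      (hχ.comp (contDiff_const.smul hη)).smul hBs
    have h := hC₂ _ hs 0 y
    rw [norm_iteratedFDeriv_zero, zero_add] at h
    rw [heq, mul_assoc]
    exact h.trans (mul_le_mul_of_nonneg_left (hC₃ r hr hr1 j hjk y) hC₂0)
  choose C hC0 hC using key
  refine ⟨|C₁| * ∑ j ∈ Finset.range (k + 1), C j,
    mul_nonneg (abs_nonneg _) (Finset.sum_nonneg fun j _ => hC0 j), fun r hr hr1 y => ?_⟩
  by_cases hy : y ∈ tsupport f
  · unfold localAdjoint
    rw [norm_smul, mul_assoc, Finset.sum_mul]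
    refine mul_le_mul ((hC₁ y hy).trans (le_abs_self _)) ?_ (norm_nonneg _) (abs_nonneg _)
    refine (norm_sum_le _ _).trans (Finset.sum_le_sum fun j hj => ?_)
    exact hC j (by simpa [Nat.lt_succ_iff] using hj) r hr hr1 y
  · have h0 : localAdjoint k ρ A (fun z => χ (r⁻¹ • η z) • f z) y = 0 :=
      image_eq_zero_of_notMem_tsupport fun h =>
        hy (tsupport_smul_subset_right _ _ (tsupport_localAdjoint_subset k ρ A _ h))
    rw [h0, norm_zero]
    exact mul_nonneg (mul_nonneg (abs_nonneg _) (Finset.sum_nonneg fun j _ => hC0 j)) (by positivity)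

end LocalAdjoint

/-! ### Test sections, fundamental lemmas and partitions of unity -/

section TestSections

variable {n : ℕ} {M : Type*} [TopologicalSpace M] [ChartedSpace (EuclideanSpace ℝ (Fin n)) M]
  [IsManifold (𝓡 n) ∞ M] [T2Space M]
  {F : Type*} [NormedAddCommGroup F] [NormedSpace ℝ F]
  {E : M → Type*} [∀ x, AddCommGroup (E x)] [∀ x, Module ℝ (E x)] [∀ x, TopologicalSpace (E x)]
  [TopologicalSpace (TotalSpace F E)] [FiberBundle F E] [VectorBundle ℝ F E]
  [ContMDiffVectorBundle ∞ F E (𝓡 n)]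

local notation "𝔼" => EuclideanSpace ℝ (Fin n)

variable (F E) in
/-- The local representative of a section, extended by zero. -/
def extendedRep (p : M) (v : ∀ x, E x) : 𝔼 → F :=
  (chartAt 𝔼 p '' patch (n := n) F E p).indicator (localRep F E p v)

theorem extendedRep_chart {p x : M} (hx : x ∈ patch (n := n) F E p) (v : ∀ x, E x) :
    extendedRep F E p v (chartAt 𝔼 p x) = localRep F E p v (chartAt 𝔼 p x) :=
  indicator_of_mem (mem_image_of_mem _ hx) _

theorem tsupport_extendedRep_subset {p : M} {v : ∀ x, E x} (hc : IsCompact (sectionSupport v))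
    (hp : sectionSupport v ⊆ patch (n := n) F E p) :
    tsupport (extendedRep (n := n) F E p v) ⊆ chartAt 𝔼 p '' sectionSupport v := by
  refine closure_minimal (fun y hy => ?_)
    (hc.image_of_continuousOn ((chartAt 𝔼 p).continuousOn.mono fun x hx => (hp hx).1)).isClosed
  have hyp : y ∈ chartAt 𝔼 p '' patch (n := n) F E p := by
    by_contra h
    exact hy (indicator_of_notMem h _)
  obtain ⟨x, hx, rfl⟩ := hyp
  refine mem_image_of_mem _ ?_
  by_contra hxs
  refine hy ?_
  rw [extendedRep_chart hx]
  refine localRep_eq_zero ?_ ?_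
  · rw [(chartAt 𝔼 p).left_inv hx.1]
    exact hx.2
  · rw [(chartAt 𝔼 p).left_inv hx.1]
    exact eq_zero_of_notMem_sectionSupport hxs

theorem hasCompactSupport_extendedRep {p : M} {v : ∀ x, E x} (hc : IsCompact (sectionSupport v))
    (hp : sectionSupport v ⊆ patch (n := n) F E p) :
    HasCompactSupport (extendedRep (n := n) F E p v) :=
  (hc.image_of_continuousOn ((chartAt 𝔼 p).continuousOn.mono fun _ hx =>
    (hp hx).1)).of_isClosed_subset (isClosed_tsupport _) (tsupport_extendedRep_subset hc hp)

theorem contDiff_extendedRep {p : M} {v : ∀ x, E x} (hv : IsSmoothOn (n := n) F E univ v)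
    (hc : IsCompact (sectionSupport v)) (hp : sectionSupport v ⊆ patch (n := n) F E p) :
    ContDiff ℝ ∞ (extendedRep (n := n) F E p v) := by
  refine contDiff_of_tsupport fun y hy => ?_
  have hop := isOpen_chart_image (isOpen_patch F E p) (fun x (hx : x ∈ patch (n := n) F E p) => hx.1)
  have hyp := image_mono hp (tsupport_extendedRep_subset hc hp hy)
  refine ((contDiffOn_localRep hv p (isOpen_patch F E p) subset_rfl (subset_univ _)).contDiffAt
    (hop.mem_nhds hyp)).congr_of_eventuallyEq ?_
  filter_upwards [hop.mem_nhds hyp] with z hz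
  exact indicator_of_mem hz _

theorem sectionOfLocal_extendedRep {p : M} {v : ∀ x, E x}
    (hp : sectionSupport v ⊆ patch (n := n) F E p) (x : M) :
    sectionOfLocal E p (extendedRep (n := n) F E p v) x = v x := by
  by_cases hx : x ∈ patch (n := n) F E p
  · apply eq_of_trivialization_eq hx.2
    rw [trivialization_sectionOfLocal _ hx, extendedRep_chart hx, localRep_chart hx.1]
  · rw [eq_zero_of_notMem_sectionSupport fun h => hx (hp h)]
    -- The point may lie in the chart domain without lying in the patch; injectivity of the chart
    -- keeps its image out of the image of the patch, where `extendedRep` is zero.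
    refine sectionOfLocal_eq_zero fun hxs => indicator_of_notMem ?_ _
    rintro ⟨z, hz, hzx⟩
    exact hx ((chartAt 𝔼 p).injOn hz.1 hxs hzx ▸ hz)

theorem isSmoothOn_of_contMDiffSection (v : Cₛ^∞⟮𝓡 n; F, E⟯) (Ω : Set M) :
    IsSmoothOn (n := n) F E Ω ⇑v :=
  v.contMDiff.contMDiffOn

theorem continuousAt_dual_apply {Ω : Set M} (hΩ : IsOpen Ω) {φ : ∀ x, Dual E x}
    (hφ : IsSmoothOn (n := n) (F →L[ℝ] ℝ) (Dual E) Ω φ) {v : ∀ x, E x}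
    (hv : IsSmoothOn (n := n) F E Ω v) {x : M} (hxΩ : x ∈ Ω) :
    ContinuousAt (fun x => (φ x (v x) : ℝ)) x := by
  have hU : IsOpen (patch (n := n) F E x ∩ Ω) := (isOpen_patch F E x).inter hΩ
  have hxU : x ∈ patch (n := n) F E x ∩ Ω := ⟨mem_patch F E x, hxΩ⟩
  have hop := isOpen_chart_image (p := x) hU (fun z hz => hz.1.1)
  have h1 := contDiffOn_localRep hv x hU inter_subset_left inter_subset_right
  have h2 := contDiffOn_localRep hφ x hU
    (by rw [patch_dual]; exact inter_subset_left) inter_subset_right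
  have hcont : ContinuousAt (chartAt 𝔼 x) x :=
    (chartAt 𝔼 x).continuousAt (mem_chart_source 𝔼 x)
  have hn := hop.mem_nhds (mem_image_of_mem (chartAt 𝔼 x) hxU)
  have h3 : ContinuousAt (fun z => (localRep (F →L[ℝ] ℝ) (Dual E) x φ (chartAt 𝔼 x z))
      (localRep F E x v (chartAt 𝔼 x z))) x :=
    ContinuousAt.clm_apply
      (ContinuousAt.comp (f := chartAt 𝔼 x) (h2.continuousOn.continuousAt hn) hcont)
      (ContinuousAt.comp (f := chartAt 𝔼 x) (h1.continuousOn.continuousAt hn) hcont)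
  refine h3.congr ?_
  filter_upwards [hU.mem_nhds hxU] with z hz
  exact localRep_dual_apply hz.1 _ _

theorem continuous_dual_apply {Ω : Set M} (hΩ : IsOpen Ω)
    (φ : testSections (n := n) (F →L[ℝ] ℝ) (Dual E) Ω) {v : ∀ x, E x}
    (hv : IsSmoothOn (n := n) F E Ω v) : Continuous (fun x => (φ.1 x (v x) : ℝ)) := by
  rw [continuous_iff_continuousAt]
  intro x
  by_cases hx : x ∈ sectionSupport ⇑φ.1
  · exact continuousAt_dual_apply hΩ (isSmoothOn_of_contMDiffSection φ.1 Ω) hv (φ.2.2 hx)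
  · refine (continuousAt_const (y := (0 : ℝ))).congr ?_
    filter_upwards [notMem_sectionSupport_iff.1 hx] with z hz
    rw [hz]
    rfl

theorem hasCompactSupport_dual_apply {Ω : Set M}
    (φ : testSections (n := n) (F →L[ℝ] ℝ) (Dual E) Ω) (v : ∀ x, E x) :
    HasCompactSupport (fun x => (φ.1 x (v x) : ℝ)) := by
  refine φ.2.1.of_isClosed_subset (isClosed_tsupport _) (closure_mono fun x hx h0 => hx ?_)
  simp only [h0]
  rfl

theorem integrable_dual_apply [MeasurableSpace M] [BorelSpace M] {vol : Measure M}
    [IsFiniteMeasureOnCompacts vol] {Ω : Set M} (hΩ : IsOpen Ω)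
    (φ : testSections (n := n) (F →L[ℝ] ℝ) (Dual E) Ω) {v : ∀ x, E x}
    (hv : IsSmoothOn (n := n) F E Ω v) : Integrable (fun x => (φ.1 x (v x) : ℝ)) vol :=
  (continuous_dual_apply hΩ φ hv).integrable_of_hasCompactSupport (hasCompactSupport_dual_apply φ v)

variable (F E) in
/-- Enlarging the set in which the supports of test sections lie. -/
def testSectionsMono {Ω Ω' : Set M} (h : Ω ⊆ Ω') (φ : testSections (n := n) F E Ω) :
    testSections (n := n) F E Ω' :=
  ⟨φ.1, φ.2.1, φ.2.2.trans h⟩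

/-- Fundamental lemma: smooth sections with the same pairings with all test sections agree. -/
theorem eqOn_of_forall_integral_eq [MeasurableSpace M] [BorelSpace M] {vol : Measure M}
    [IsFiniteMeasureOnCompacts vol] [vol.IsOpenPosMeasure] {Ω : Set M} (hΩ : IsOpen Ω)
    {v w : ∀ x, E x} (hv : IsSmoothOn (n := n) F E Ω v) (hw : IsSmoothOn (n := n) F E Ω w)
    (h : ∀ φ : testSections (n := n) (F →L[ℝ] ℝ) (Dual E) Ω,
      (∫ x, (φ.1 x (v x) : ℝ) ∂vol) = ∫ x, (φ.1 x (w x) : ℝ) ∂vol) {p : M} (hp : p ∈ Ω) :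
    v p = w p := by
  by_contra hne
  set c := chartAt 𝔼 p
  set U := patch (n := n) F E p ∩ Ω
  have hU : IsOpen U := (isOpen_patch F E p).inter hΩ
  have hpU : p ∈ U := ⟨mem_patch F E p, hp⟩
  have hop : IsOpen (c '' U) := isOpen_chart_image hU (fun z hz => hz.1.1)
  have h1 := contDiffOn_localRep hv p hU inter_subset_left inter_subset_right
  have h2 := contDiffOn_localRep hw p hU inter_subset_left inter_subset_right
  have hd : localRep F E p v (c p) - localRep F E p w (c p) ≠ 0 := by
    intro h0
    refine hne (eq_of_trivialization_eq (mem_patch (n := n) F E p).2 ?_)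
    rw [← localRep_chart (n := n) (mem_patch (n := n) F E p).1,
      ← localRep_chart (n := n) (mem_patch (n := n) F E p).1]
    exact sub_eq_zero.1 h0
  obtain ⟨ℓ, hℓ⟩ := SeparatingDual.exists_eq_one (R := ℝ) hd
  have hcont : ContinuousOn (fun y => ℓ (localRep F E p v y - localRep F E p w y)) (c '' U) :=
    ℓ.continuous.comp_continuousOn (h1.continuousOn.sub h2.continuousOn)
  have hO : IsOpen (c '' U ∩ (fun y => ℓ (localRep F E p v y - localRep F E p w y)) ⁻¹' Ioi 0) :=
    hcont.isOpen_inter_preimage hop isOpen_Ioi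
  -- The bump `ψ` is supported where `ℓ` is positive on `v - w`. Testing with `ψ ℓ` therefore gives
  -- a nonnegative integrand that is positive at `p`, hence a positive integral.
  obtain ⟨ψ, hψs, hψc, hψd, hψr, hψ1⟩ := exists_contDiff_tsupport_subset (n := (⊤ : ℕ∞))
    (hO.mem_nhds (x := c p) ⟨mem_image_of_mem _ hpU, by
      rw [mem_preimage, hℓ]
      exact zero_lt_one' ℝ⟩)
  have hψU : tsupport (fun y => ψ y • ℓ) ⊆ tsupport ψ := tsupport_smul_subset_left _ _
  have hsub : tsupport (fun y => ψ y • ℓ) ⊆ c '' U := hψU.trans (hψs.trans inter_subset_left)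
  let φ : testSections (n := n) (F →L[ℝ] ℝ) (Dual E) Ω :=
    testSectionOfLocal p (fun y => ψ y • ℓ) (hψd.smul contDiff_const)
      (hψc.of_isClosed_subset (isClosed_tsupport _) hψU)
      (hsub.trans (by rw [patch_dual]; exact image_mono inter_subset_left))
      (by
        rintro _ ⟨y, hy, rfl⟩
        exact (chart_symm_mem (fun z hz => hz.1.1) (hsub hy)).1.2)
  have hφ : ∀ x ∈ patch (n := n) F E p, (φ.1 x (v x) : ℝ) - φ.1 x (w x) =
      ψ (c x) * ℓ (localRep F E p v (c x) - localRep F E p w (c x)) := by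
    intro x hx
    rw [← localRep_dual_apply hx, ← localRep_dual_apply hx]
    have : localRep (F →L[ℝ] ℝ) (Dual E) p φ.1 (chartAt 𝔼 p x) = ψ (c x) • ℓ :=
      localRep_sectionOfLocal (fun y => ψ y • ℓ) (mem_image_of_mem _ (by rwa [patch_dual]))
    rw [this]
    simp only [smul_apply, smul_eq_mul, map_sub]
    ring
  have hnn : ∀ x, 0 ≤ (φ.1 x (v x) : ℝ) - φ.1 x (w x) := by
    intro x
    by_cases hx : x ∈ patch (n := n) F E p
    · rw [hφ x hx]
      by_cases hy : c x ∈ tsupport ψ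
      · exact mul_nonneg (hψr (mem_range_self _)).1 (hψs hy).2.le
      · rw [image_eq_zero_of_notMem_tsupport hy, zero_mul]
    · have h0 : φ.1 x = 0 := eq_zero_of_notMem_sectionSupport fun h => hx (by
        obtain ⟨y, hy, rfl⟩ := sectionSupport_sectionOfLocal_subset
          (hψc.of_isClosed_subset (isClosed_tsupport _) hψU) (fun z hz => hz.1.1) hsub h
        exact (chart_symm_mem (fun z hz => hz.1.1) (hsub hy)).1.1)
      rw [h0]
      simp
  have hpos := ((continuous_dual_apply hΩ φ hv).sub
    (continuous_dual_apply hΩ φ hw)).integral_pos_of_hasCompactSupport_nonneg_nonzero (μ := vol)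
    ((hasCompactSupport_dual_apply φ v).sub (hasCompactSupport_dual_apply φ w)) hnn (x := p)
    (by
      simp only [Pi.sub_apply]
      rw [hφ p hpU.1, hψ1, hℓ]
      norm_num)
  simp only [Pi.sub_apply] at hpos
  rw [integral_sub (integrable_dual_apply hΩ φ hv) (integrable_dual_apply hΩ φ hw), h φ,
    sub_self] at hpos
  exact lt_irrefl _ hpos

/-- Fundamental lemma: test sections of the dual bundle with the same pairings with all smooth
sections agree. -/
theorem testSection_eq_of_forall_integral_eq [MeasurableSpace M] [BorelSpace M] {vol : Measure M}
    [IsFiniteMeasureOnCompacts vol] [vol.IsOpenPosMeasure] {Ω₁ Ω₂ : Set M}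
    (φ₁ : testSections (n := n) (F →L[ℝ] ℝ) (Dual E) Ω₁)
    (φ₂ : testSections (n := n) (F →L[ℝ] ℝ) (Dual E) Ω₂)
    (h : ∀ v : Cₛ^∞⟮𝓡 n; F, E⟯,
      (∫ x, (φ₁.1 x (v x) : ℝ) ∂vol) = ∫ x, (φ₂.1 x (v x) : ℝ) ∂vol) : φ₁.1 = φ₂.1 := by
  ext p : 1
  by_contra hne
  set c := chartAt 𝔼 p
  set U := patch (n := n) F E p
  have hU : IsOpen U := isOpen_patch F E p
  have hpU : p ∈ U := mem_patch F E p
  have hop : IsOpen (c '' U) := isOpen_chart_image hU (fun z hz => hz.1)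
  have hU' : U ⊆ patch (n := n) (F →L[ℝ] ℝ) (Dual E) p := by rw [patch_dual]
  have h1 := contDiffOn_localRep (isSmoothOn_of_contMDiffSection φ₁.1 univ) p hU hU' (subset_univ _)
  have h2 := contDiffOn_localRep (isSmoothOn_of_contMDiffSection φ₂.1 univ) p hU hU' (subset_univ _)
  set f₁ := localRep (n := n) (F →L[ℝ] ℝ) (Dual E) p φ₁.1
  set f₂ := localRep (n := n) (F →L[ℝ] ℝ) (Dual E) p φ₂.1
  have hd : f₁ (c p) - f₂ (c p) ≠ 0 := by
    intro h0
    refine hne (eq_of_trivialization_eq (F := F →L[ℝ] ℝ) (E := Dual E) (hU' hpU).2 ?_)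
    rw [← localRep_chart (n := n) (hU' hpU).1, ← localRep_chart (n := n) (hU' hpU).1]
    exact sub_eq_zero.1 h0
  -- The roles of sections and functionals are now exchanged: `e` is a vector on which the
  -- difference of the functionals is positive, and the smooth section used for testing is a bump
  -- times `e`.
  obtain ⟨e, he⟩ : ∃ e, 0 < (f₁ (c p) - f₂ (c p)) e := by
    by_contra! hc
    refine hd (ContinuousLinearMap.ext fun e => le_antisymm (hc e) ?_)
    have := hc (-e)
    rw [map_neg] at this
    simpa using this
  have hcont : ContinuousOn (fun y => (f₁ y - f₂ y) e) (c '' U) :=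
    (h1.continuousOn.sub h2.continuousOn).clm_apply continuousOn_const
  have hO : IsOpen (c '' U ∩ (fun y => (f₁ y - f₂ y) e) ⁻¹' Ioi 0) :=
    hcont.isOpen_inter_preimage hop isOpen_Ioi
  obtain ⟨ψ, hψs, hψc, hψd, hψr, hψ1⟩ := exists_contDiff_tsupport_subset (n := (⊤ : ℕ∞))
    (hO.mem_nhds (x := c p) ⟨mem_image_of_mem _ hpU, he⟩)
  have hψU : tsupport (fun y => ψ y • e) ⊆ tsupport ψ := tsupport_smul_subset_left _ _
  have hsub : tsupport (fun y => ψ y • e) ⊆ c '' U := hψU.trans (hψs.trans inter_subset_left)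
  have hcs : HasCompactSupport (fun y => ψ y • e) :=
    hψc.of_isClosed_subset (isClosed_tsupport _) hψU
  let v : Cₛ^∞⟮𝓡 n; F, E⟯ := ⟨sectionOfLocal E p (fun y => ψ y • e),
    contMDiff_sectionOfLocal (hψd.smul contDiff_const) hcs hsub⟩
  have hφ : ∀ x ∈ U, (φ₁.1 x (v x) : ℝ) - φ₂.1 x (v x) = ψ (c x) * (f₁ (c x) - f₂ (c x)) e := by
    intro x hx
    rw [← localRep_dual_apply hx, ← localRep_dual_apply hx]
    have : localRep F E p v (chartAt 𝔼 p x) = ψ (c x) • e :=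
      localRep_sectionOfLocal (fun y => ψ y • e) (mem_image_of_mem _ hx)
    rw [this]
    simp only [map_smul, smul_eq_mul, sub_apply, f₁, f₂, c]
    ring
  have hnn : ∀ x, 0 ≤ (φ₁.1 x (v x) : ℝ) - φ₂.1 x (v x) := by
    intro x
    by_cases hx : x ∈ U
    · rw [hφ x hx]
      by_cases hy : c x ∈ tsupport ψ
      · exact mul_nonneg (hψr (mem_range_self _)).1 (hψs hy).2.le
      · rw [image_eq_zero_of_notMem_tsupport hy, zero_mul]
    · have h0 : v x = 0 := eq_zero_of_notMem_sectionSupport fun h => hx (by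
        obtain ⟨y, hy, rfl⟩ := sectionSupport_sectionOfLocal_subset hcs (fun z hz => hz.1) hsub h
        exact (chart_symm_mem (fun z hz => hz.1) (hsub hy)).1)
      rw [h0, map_zero, map_zero, sub_zero]
  have hc1 := continuous_dual_apply isOpen_univ
    (testSectionsMono (F →L[ℝ] ℝ) (Dual E) (subset_univ _) φ₁)
    (isSmoothOn_of_contMDiffSection v univ)
  have hc2 := continuous_dual_apply isOpen_univ
    (testSectionsMono (F →L[ℝ] ℝ) (Dual E) (subset_univ _) φ₂)
    (isSmoothOn_of_contMDiffSection v univ)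
  have hs1 := hasCompactSupport_dual_apply φ₁ v
  have hs2 := hasCompactSupport_dual_apply φ₂ v
  have hpos := (hc1.sub hc2).integral_pos_of_hasCompactSupport_nonneg_nonzero (μ := vol)
    (hs1.sub hs2) hnn (x := p)
    (by
      have := hφ p hpU
      rw [hψ1, one_mul] at this
      exact this.trans_ne he.ne')
  have h3 := integral_sub (hc1.integrable_of_hasCompactSupport (μ := vol) hs1)
    (hc2.integrable_of_hasCompactSupport (μ := vol) hs2)
  have h4 := h v
  refine hpos.ne' (h3.trans (sub_eq_zero.2 h4))

theorem coe_sum_testSections {ι : Type*} {Ω : Set M} (s : Finset ι)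
    (ψ : ι → testSections (n := n) F E Ω) (x : M) :
    (∑ i ∈ s, ψ i).1 x = ∑ i ∈ s, (ψ i).1 x := by
  rw [Submodule.coe_sum]
  have := congrFun (map_sum (ContMDiffSection.coeAddHom (𝓡 n) F ∞ E) (fun i => (ψ i).1) s) x
  rw [Finset.sum_apply] at this
  exact this

theorem testSections_sum_apply {ι : Type*} {Ω : Set M} (s : Finset ι)
    (ψ : ι → testSections (n := n) (F →L[ℝ] ℝ) (Dual E) Ω) (x : M) (v : E x) :
    ((∑ i ∈ s, ψ i).1 x v : ℝ) = ∑ i ∈ s, ((ψ i).1 x v : ℝ) := by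
  rw [coe_sum_testSections]
  exact sum_apply _ _ _

/-- Decomposition of a test section into test sections with small supports. -/
theorem exists_sum_testSections [SigmaCompactSpace M] {Ω : Set M}
    (φ : testSections (n := n) F E Ω) {U : M → Set M} (hU : ∀ x, U x ∈ 𝓝 x) :
    ∃ (s : Finset M) (ψ : M → testSections (n := n) F E Ω), φ = ∑ p ∈ s, ψ p ∧
      ∀ p ∈ s, sectionSupport ⇑(ψ p).1 ⊆ sectionSupport ⇑φ.1 ∩ U p := by
  obtain ⟨f, hf⟩ := SmoothPartitionOfUnity.exists_isSubordinate (𝓡 n)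
    (isClosed_closure : IsClosed (sectionSupport ⇑φ.1)) (fun x => interior (U x))
    (fun x => isOpen_interior) fun x _ => mem_iUnion.2 ⟨x, mem_interior_iff_mem_nhds.2 (hU x)⟩
  -- Local finiteness of the partition and compactness of the support leave finitely many indices.
  have hfin := f.locallyFinite.finite_nonempty_inter_compact φ.2.1
  have hsupp (p : M) : sectionSupport (fun x => f p x • φ.1 x) ⊆
      sectionSupport ⇑φ.1 ∩ tsupport (f p) := by
    refine subset_inter (closure_mono fun x hx h0 => hx ?_) (closure_mono fun x hx h0 => hx ?_)
    · simp only [h0, smul_zero]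
    · simp only [h0, zero_smul]
  let ψ (p : M) : testSections (n := n) F E Ω :=
    ⟨⟨fun x => f p x • φ.1 x, (f p).contMDiff.smul_section φ.1.contMDiff⟩,
      φ.2.1.of_isClosed_subset isClosed_closure ((hsupp p).trans inter_subset_left),
      ((hsupp p).trans inter_subset_left).trans φ.2.2⟩
  refine ⟨hfin.toFinset, ψ, ?_, fun p _ => (hsupp p).trans
    (inter_subset_inter_right _ ((hf p).trans interior_subset))⟩
  apply Subtype.ext
  ext x : 1
  have hsum : (∑ p ∈ hfin.toFinset, ψ p).1 x = ∑ p ∈ hfin.toFinset, f p x • φ.1 x :=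
    coe_sum_testSections _ ψ x
  rw [hsum, ← Finset.sum_smul]
  by_cases hx : x ∈ sectionSupport ⇑φ.1
  · have h1 := f.sum_eq_one hx
    rw [finsum_eq_sum_of_support_subset] at h1
    · rw [h1, one_smul]
    · intro p hp
      simp only [Finite.coe_toFinset]
      exact ⟨x, hp, hx⟩
  · rw [eq_zero_of_notMem_sectionSupport hx, smul_zero]

end TestSections

/-! ### Existence, uniqueness and locality of the formal dual -/

section FormalDual

variable {n : ℕ} {M : Type*} [TopologicalSpace M] [ChartedSpace (EuclideanSpace ℝ (Fin n)) M]
  [IsManifold (𝓡 n) ∞ M] [T2Space M]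
  {F : Type*} [NormedAddCommGroup F] [NormedSpace ℝ F]
  {E : M → Type*} [∀ x, AddCommGroup (E x)] [∀ x, Module ℝ (E x)] [∀ x, TopologicalSpace (E x)]
  [TopologicalSpace (TotalSpace F E)] [FiberBundle F E] [VectorBundle ℝ F E]
  [ContMDiffVectorBundle ∞ F E (𝓡 n)]
  {F' : Type*} [NormedAddCommGroup F'] [NormedSpace ℝ F']
  {E' : M → Type*} [∀ x, AddCommGroup (E' x)] [∀ x, Module ℝ (E' x)]
  [∀ x, TopologicalSpace (E' x)]
  [TopologicalSpace (TotalSpace F' E')] [FiberBundle F' E'] [VectorBundle ℝ F' E']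
  [ContMDiffVectorBundle ∞ F' E' (𝓡 n)]
  [MeasurableSpace M] [BorelSpace M] {vol : Measure M}

local notation "𝔼" => EuclideanSpace ℝ (Fin n)

variable (n F E F' E') in
/-- The common domain of the chart and of the trivializations of `E` and `E'` at `p`. -/
def jointPatch (p : M) : Set M := patch (n := n) F E p ∩ patch (n := n) F' E' p

theorem isOpen_jointPatch (p : M) : IsOpen (jointPatch n F E F' E' p) :=
  (isOpen_patch F E p).inter (isOpen_patch F' E' p)

theorem jointPatch_subset_source (p : M) : jointPatch n F E F' E' p ⊆ (chartAt 𝔼 p).source :=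
  fun _ hx => hx.1.1

/-- Data representing the operator `L` and the measure in the preferred chart at `p`. -/
structure LocalData (k : ℕ) (L : Cₛ^∞⟮𝓡 n; F, E⟯ →ₗ[ℝ] Cₛ^∞⟮𝓡 n; F', E'⟯) (vol : Measure M)
    (p : M) where
  /-- the coefficients of the operator -/
  coeff : ∀ j : ℕ, 𝔼 → ((𝔼 [×j]→L[ℝ] F) →L[ℝ] F')
  contDiffOn_coeff : ∀ j ≤ k, ContDiffOn ℝ ∞ (coeff j) (chartAt 𝔼 p '' jointPatch n F E F' E' p)
  localRep_apply : ∀ v : Cₛ^∞⟮𝓡 n; F, E⟯, ∀ y ∈ chartAt 𝔼 p '' jointPatch n F E F' E' p,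
    localRep F' E' p ⇑(L v) y =
      ∑ j ∈ Finset.range (k + 1), coeff j y (iteratedFDeriv ℝ j (localRep F E p ⇑v) y)
  /-- the density of the measure -/
  density : 𝔼 → ℝ
  contDiffOn_density : ContDiffOn ℝ ∞ density (chartAt 𝔼 p).target
  density_pos : ∀ y ∈ (chartAt 𝔼 p).target, 0 < density y
  measure_eq : ∀ A : Set M, MeasurableSet A → A ⊆ (chartAt 𝔼 p).source →
      vol A = ∫⁻ y in chartAt 𝔼 p '' A, ENNReal.ofReal (density y)

theorem nonempty_localData {k : ℕ} {L : Cₛ^∞⟮𝓡 n; F, E⟯ →ₗ[ℝ] Cₛ^∞⟮𝓡 n; F', E'⟯}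
    (hL : IsDiffOp k L) (hvol : IsSmoothPositiveDensity n vol) (p : M) :
    Nonempty (LocalData k L vol p) := by
  obtain ⟨A, hA, hLA⟩ := hL p
  obtain ⟨ρ, hρ, hpos, h⟩ := hvol p
  exact ⟨⟨A, hA, hLA, ρ, hρ, hpos, h⟩⟩

variable {k : ℕ} {L : Cₛ^∞⟮𝓡 n; F, E⟯ →ₗ[ℝ] Cₛ^∞⟮𝓡 n; F', E'⟯} {p : M}

namespace LocalData

variable (D : LocalData k L vol p)

theorem image_subset_target : chartAt 𝔼 p '' jointPatch n F E F' E' p ⊆ (chartAt 𝔼 p).target := by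
  rintro _ ⟨x, hx, rfl⟩
  exact (chartAt 𝔼 p).map_source (jointPatch_subset_source p hx)

theorem isOpen_image : IsOpen (chartAt 𝔼 p '' jointPatch n F E F' E' p) :=
  isOpen_chart_image (isOpen_jointPatch p) (jointPatch_subset_source p)

/-- The formal adjoint in the chart at `p`. -/
def adjoint (f : 𝔼 → F' →L[ℝ] ℝ) : 𝔼 → F →L[ℝ] ℝ :=
  localAdjoint k D.density D.coeff f

theorem tsupport_adjoint_subset (f : 𝔼 → F' →L[ℝ] ℝ) : tsupport (D.adjoint f) ⊆ tsupport f :=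
  tsupport_localAdjoint_subset _ _ _ _

theorem hasCompactSupport_adjoint {f : 𝔼 → (F' →L[ℝ] ℝ)}
    (hfc : HasCompactSupport f) : HasCompactSupport (D.adjoint f) :=
  hfc.of_isClosed_subset (isClosed_tsupport _) (D.tsupport_adjoint_subset f)

theorem contDiff_adjoint {f : 𝔼 → (F' →L[ℝ] ℝ)}
    (hf : ContDiff ℝ ∞ f)
    (hfU : tsupport f ⊆ chartAt 𝔼 p '' jointPatch n F E F' E' p) : ContDiff ℝ ∞ (D.adjoint f) :=
  contDiff_localAdjoint isOpen_image (D.contDiffOn_density.mono image_subset_target)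
    (fun y hy => D.density_pos y (image_subset_target hy)) D.contDiffOn_coeff hf hfU

/-- Both integrals are transported to the chart, where the density becomes the weight in
`integral_localAdjoint`. -/
theorem integral_eq {f : 𝔼 → (F' →L[ℝ] ℝ)}
    (hf : ContDiff ℝ ∞ f) (hfc : HasCompactSupport f)
    (hfU : tsupport f ⊆ chartAt 𝔼 p '' jointPatch n F E F' E' p) (v : Cₛ^∞⟮𝓡 n; F, E⟯) :
    (∫ x, (sectionOfLocal (Dual E') p f x (L v x) : ℝ) ∂vol) =
      ∫ x, (sectionOfLocal (Dual E) p (D.adjoint f) x (v x) : ℝ) ∂vol := by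
  set U := jointPatch n F E F' E' p
  have hsrc : ∀ x ∈ U, x ∈ (chartAt 𝔼 p).source := jointPatch_subset_source p
  have hU1 : U ⊆ patch (n := n) (F →L[ℝ] ℝ) (Dual E) p := by
    rw [patch_dual]; exact inter_subset_left
  have hU2 : U ⊆ patch (n := n) (F' →L[ℝ] ℝ) (Dual E') p := by
    rw [patch_dual]; exact inter_subset_right
  have hgU := (D.tsupport_adjoint_subset f).trans hfU
  have hgs := D.contDiff_adjoint hf hfU
  have hgc := D.hasCompactSupport_adjoint hfc
  -- Packaging `f` and its adjoint as test sections supplies continuity of the pairings, hence the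
  -- measurability required by the change of variables.
  let φ : testSections (n := n) (F' →L[ℝ] ℝ) (Dual E') univ :=
    testSectionOfLocal p f hf hfc (hfU.trans (image_mono hU2)) (subset_univ _)
  let Φ : testSections (n := n) (F →L[ℝ] ℝ) (Dual E) univ :=
    testSectionOfLocal p (D.adjoint f) hgs hgc (hgU.trans (image_mono hU1)) (subset_univ _)
  have hzf {y : 𝔼} (hy : y ∉ chartAt 𝔼 p '' U) : f y = 0 :=
    image_eq_zero_of_notMem_tsupport fun h => hy (hfU h)
  have hzg {y : 𝔼} (hy : y ∉ chartAt 𝔼 p '' U) : D.adjoint f y = 0 :=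
    image_eq_zero_of_notMem_tsupport fun h => hy (hgU h)
  have hnot {x : M} (hx : x ∉ U) (hxs : x ∈ (chartAt 𝔼 p).source) :
      chartAt 𝔼 p x ∉ chartAt 𝔼 p '' U := by
    rintro ⟨z, hz, hzx⟩
    exact hx ((chartAt 𝔼 p).injOn (hsrc z hz) hxs hzx ▸ hz)
  have e1 := integral_eq_integral_chart D.contDiffOn_density D.density_pos D.measure_eq
    (continuous_dual_apply isOpen_univ φ
      (isSmoothOn_of_contMDiffSection (L v) univ)).aestronglyMeasurable
    (U := U) (jointPatch_subset_source p)
    (fun x hx => by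
      have h0 : φ.1 x = 0 := sectionOfLocal_eq_zero fun hxs => hzf (hnot hx hxs)
      rw [h0]
      rfl)
    (f := fun y => D.density y * f y (∑ j ∈ Finset.range (k + 1),
      D.coeff j y (iteratedFDeriv ℝ j (localRep F E p ⇑v) y)))
    (fun x hx => by
      have h1 := localRep_dual_apply (n := n) (F := F') (E := E') hx.2 (⇑φ.1) (⇑(L v))
      have h2 : localRep (F' →L[ℝ] ℝ) (Dual E') p φ.1 (chartAt 𝔼 p x) = f (chartAt 𝔼 p x) :=
        localRep_sectionOfLocal f (mem_image_of_mem _ (hU2 hx))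
      rw [h2, D.localRep_apply v _ (mem_image_of_mem _ hx)] at h1
      rw [← h1])
    (fun y hy => by simp [hzf hy])
  have e2 := integral_eq_integral_chart D.contDiffOn_density D.density_pos D.measure_eq
    (continuous_dual_apply isOpen_univ Φ
      (isSmoothOn_of_contMDiffSection v univ)).aestronglyMeasurable
    (U := U) (jointPatch_subset_source p)
    (fun x hx => by
      have h0 : Φ.1 x = 0 := sectionOfLocal_eq_zero fun hxs => hzg (hnot hx hxs)
      rw [h0]
      rfl)
    (f := fun y => D.density y * D.adjoint f y (localRep F E p ⇑v y))
    (fun x hx => by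
      have h1 := localRep_dual_apply (n := n) (F := F) (E := E) hx.1 (⇑Φ.1) (⇑v)
      have h2 : localRep (F →L[ℝ] ℝ) (Dual E) p Φ.1 (chartAt 𝔼 p x) =
          D.adjoint f (chartAt 𝔼 p x) :=
        localRep_sectionOfLocal _ (mem_image_of_mem _ (hU1 hx))
      rw [h2] at h1
      rw [← h1])
    (fun y hy => by simp [hzg hy])
  refine e1.trans (Eq.trans ?_ e2.symm)
  exact integral_localAdjoint isOpen_image (D.contDiffOn_density.mono image_subset_target)
    (fun y hy => D.density_pos y (image_subset_target hy)) D.contDiffOn_coeff hf hfc hfU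
    (contDiffOn_localRep (isSmoothOn_of_contMDiffSection v univ) p (isOpen_jointPatch p)
      inter_subset_left (subset_univ _))

end LocalData

/-- A section supported in one patch is recovered from its local representative, and the adjoint in
the chart does not enlarge supports, so the result is again a test section over `Ω`. -/
theorem exists_dual_testSection_of_subset_patch (hL : IsDiffOp k L)
    (hvol : IsSmoothPositiveDensity n vol) {Ω : Set M}
    (φ : testSections (n := n) (F' →L[ℝ] ℝ) (Dual E') Ω)
    (hφ : sectionSupport ⇑φ.1 ⊆ jointPatch n F E F' E' p) :
    ∃ Φ : testSections (n := n) (F →L[ℝ] ℝ) (Dual E) Ω, ∀ v : Cₛ^∞⟮𝓡 n; F, E⟯,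
      (∫ x, (φ.1 x (L v x) : ℝ) ∂vol) = ∫ x, (Φ.1 x (v x) : ℝ) ∂vol := by
  obtain ⟨D⟩ := nonempty_localData hL hvol p
  have hp : sectionSupport ⇑φ.1 ⊆ patch (n := n) (F' →L[ℝ] ℝ) (Dual E') p := by
    rw [patch_dual]
    exact hφ.trans inter_subset_right
  set f := extendedRep (n := n) (F' →L[ℝ] ℝ) (Dual E') p φ.1 with hf
  have hft : tsupport f ⊆ chartAt 𝔼 p '' sectionSupport ⇑φ.1 :=
    tsupport_extendedRep_subset φ.2.1 hp
  have hfU := hft.trans (image_mono hφ)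
  have hfc : HasCompactSupport f := hasCompactSupport_extendedRep φ.2.1 hp
  have hfs : ContDiff ℝ ∞ f :=
    contDiff_extendedRep (isSmoothOn_of_contMDiffSection φ.1 univ) φ.2.1 hp
  have hgU := (D.tsupport_adjoint_subset f).trans hfU
  refine ⟨testSectionOfLocal p (D.adjoint f) (D.contDiff_adjoint hfs hfU)
    (D.hasCompactSupport_adjoint hfc)
    (hgU.trans (by rw [patch_dual]; exact image_mono inter_subset_left)) ?_, fun v => ?_⟩
  · rintro _ ⟨y, hy, rfl⟩
    obtain ⟨x, hx, rfl⟩ := hft (D.tsupport_adjoint_subset f hy)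
    rw [(chartAt 𝔼 p).left_inv (hp hx).1]
    exact φ.2.2 hx
  · have h := D.integral_eq hfs hfc hfU v
    simp only [hf, sectionOfLocal_extendedRep hp] at h
    exact h

variable [SigmaCompactSpace M]

theorem exists_dual_testSection (hL : IsDiffOp k L)
    (hvol : IsSmoothPositiveDensity n vol) {Ω : Set M}
    (φ : testSections (n := n) (F' →L[ℝ] ℝ) (Dual E') Ω) :
    ∃ Φ : testSections (n := n) (F →L[ℝ] ℝ) (Dual E) Ω, ∀ v : Cₛ^∞⟮𝓡 n; F, E⟯,
      (∫ x, (φ.1 x (L v x) : ℝ) ∂vol) = ∫ x, (Φ.1 x (v x) : ℝ) ∂vol := by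
  have := hvol.isLocallyFiniteMeasure
  obtain ⟨s, ψ, hφ, hψ⟩ := exists_sum_testSections φ (U := jointPatch n F E F' E')
    fun x => (isOpen_jointPatch x).mem_nhds ⟨mem_patch F E x, mem_patch F' E' x⟩
  have h (p : M) : ∃ Φ : testSections (n := n) (F →L[ℝ] ℝ) (Dual E) Ω, p ∈ s →
      ∀ v : Cₛ^∞⟮𝓡 n; F, E⟯,
      (∫ x, ((ψ p).1 x (L v x) : ℝ) ∂vol) = ∫ x, (Φ.1 x (v x) : ℝ) ∂vol := by
    by_cases hp : p ∈ s
    · obtain ⟨Φ, hΦ⟩ := exists_dual_testSection_of_subset_patch hL hvol (ψ p)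
        ((hψ p hp).trans inter_subset_right)
      exact ⟨Φ, fun _ => hΦ⟩
    · exact ⟨0, fun h => absurd h hp⟩
  choose Φ hΦ using h
  refine ⟨∑ p ∈ s, Φ p, fun v => ?_⟩
  have e1 (x : M) : (φ.1 x (L v x) : ℝ) = ∑ p ∈ s, ((ψ p).1 x (L v x) : ℝ) := by
    rw [hφ]
    exact testSections_sum_apply s ψ x (L v x)
  have e2 (x : M) : ((∑ p ∈ s, Φ p).1 x (v x) : ℝ) = ∑ p ∈ s, ((Φ p).1 x (v x) : ℝ) :=
    testSections_sum_apply s Φ x (v x)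
  simp only [e1, e2]
  rw [integral_finsetSum _ fun p _ => ?_, integral_finsetSum _ fun p _ => ?_]
  · exact Finset.sum_congr rfl fun p hp => hΦ p hp v
  · exact integrable_dual_apply isOpen_univ (testSectionsMono _ _ (subset_univ _) (Φ p))
      (isSmoothOn_of_contMDiffSection v univ)
  · exact integrable_dual_apply isOpen_univ (testSectionsMono _ _ (subset_univ _) (ψ p))
      (isSmoothOn_of_contMDiffSection (L v) univ)

/-- The formally dual operator exists. -/
theorem isFormalDual_formalDual (hL : IsDiffOp k L)
    (hvol : IsSmoothPositiveDensity n vol) (Ω : Set M) :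
    IsFormalDual vol L Ω (formalDual vol L Ω) := by
  have := hvol.isLocallyFiniteMeasure
  have := hvol.isOpenPosMeasure
  have hex : ∃ A, IsFormalDual vol L Ω A := by
    -- The dual test sections are chosen one by one. Linearity of the choice follows because a test
    -- section is determined by its pairings with all smooth sections.
    choose A hA using fun φ => exists_dual_testSection hL hvol (Ω := Ω) φ
    have hint (φ : testSections (n := n) (F' →L[ℝ] ℝ) (Dual E') Ω) (v : Cₛ^∞⟮𝓡 n; F', E'⟯) :
        Integrable (fun x => (φ.1 x (v x) : ℝ)) vol :=
      integrable_dual_apply isOpen_univ (testSectionsMono _ _ (subset_univ _) φ)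
        (isSmoothOn_of_contMDiffSection v univ)
    have hint' (φ : testSections (n := n) (F →L[ℝ] ℝ) (Dual E) Ω) (v : Cₛ^∞⟮𝓡 n; F, E⟯) :
        Integrable (fun x => (φ.1 x (v x) : ℝ)) vol :=
      integrable_dual_apply isOpen_univ (testSectionsMono _ _ (subset_univ _) φ)
        (isSmoothOn_of_contMDiffSection v univ)
    refine ⟨⟨⟨A, fun φ ψ => ?_⟩, fun c φ => ?_⟩, fun v φ => hA φ v⟩
    · refine Subtype.ext (testSection_eq_of_forall_integral_eq (vol := vol) _ _ fun v => ?_)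
      rw [← hA]
      exact (integral_add (hint φ (L v)) (hint ψ (L v))).trans
        ((congrArg₂ _ (hA φ v) (hA ψ v)).trans (integral_add (hint' _ v) (hint' _ v)).symm)
    · refine Subtype.ext (testSection_eq_of_forall_integral_eq (vol := vol) _ _ fun v => ?_)
      rw [← hA]
      exact (integral_const_mul c _).trans
        ((congrArg _ (hA φ v)).trans (integral_const_mul c _).symm)
  unfold formalDual
  rw [dif_pos hex]
  exact hex.choose_spec

/-- The formally dual operator is determined by its integral identity. -/
theorem formalDual_eq (hL : IsDiffOp k L)
    (hvol : IsSmoothPositiveDensity n vol) {Ω Ω' : Set M}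
    (φ : testSections (n := n) (F' →L[ℝ] ℝ) (Dual E') Ω)
    (Φ : testSections (n := n) (F →L[ℝ] ℝ) (Dual E) Ω')
    (h : ∀ v : Cₛ^∞⟮𝓡 n; F, E⟯,
      (∫ x, (φ.1 x (L v x) : ℝ) ∂vol) = ∫ x, (Φ.1 x (v x) : ℝ) ∂vol) :
    (formalDual vol L Ω φ).1 = Φ.1 := by
  have := hvol.isLocallyFiniteMeasure
  have := hvol.isOpenPosMeasure
  exact testSection_eq_of_forall_integral_eq (vol := vol) _ _ fun v =>
    (isFormalDual_formalDual hL hvol Ω v φ).symm.trans (h v)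

/-- The formally dual operators over different sets agree. -/
theorem formalDual_congr (hL : IsDiffOp k L)
    (hvol : IsSmoothPositiveDensity n vol) {Ω Ω' : Set M}
    (φ : testSections (n := n) (F' →L[ℝ] ℝ) (Dual E') Ω)
    (φ' : testSections (n := n) (F' →L[ℝ] ℝ) (Dual E') Ω') (h : φ.1 = φ'.1) :
    (formalDual vol L Ω φ).1 = (formalDual vol L Ω' φ').1 :=
  formalDual_eq hL hvol φ _ fun v => by
    rw [h]
    exact isFormalDual_formalDual hL hvol Ω' v φ'

/-- The formally dual operator in a chart. -/
theorem formalDual_testSectionOfLocal (hL : IsDiffOp k L)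
    (hvol : IsSmoothPositiveDensity n vol) (D : LocalData k L vol p) {f : 𝔼 → F' →L[ℝ] ℝ}
    (hfs : ContDiff ℝ ∞ f) (hfc : HasCompactSupport f)
    (hfU : tsupport f ⊆ chartAt 𝔼 p '' jointPatch n F E F' E' p) {Ω : Set M}
    (φ : testSections (n := n) (F' →L[ℝ] ℝ) (Dual E') Ω)
    (hφ : ∀ x, φ.1 x = sectionOfLocal (Dual E') p f x) (x : M) :
    (formalDual vol L Ω φ).1 x = sectionOfLocal (Dual E) p (D.adjoint f) x := by
  have hgU := (D.tsupport_adjoint_subset f).trans hfU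
  have h := formalDual_eq hL hvol φ
    (testSectionOfLocal (Ω := univ) (E := Dual E) p (D.adjoint f) (D.contDiff_adjoint hfs hfU)
    (D.hasCompactSupport_adjoint hfc)
    (hgU.trans (by rw [patch_dual]; exact image_mono inter_subset_left)) (subset_univ _))
    (fun v => by
      simp only [hφ]
      exact D.integral_eq hfs hfc hfU v)
  rw [h]
  rfl

end FormalDual

/-! ### Locally integrable sections as distributions -/

section Integrable

variable {n : ℕ} {M : Type*} [TopologicalSpace M] [ChartedSpace (EuclideanSpace ℝ (Fin n)) M]
  [IsManifold (𝓡 n) ∞ M] [T2Space M]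
  {F : Type*} [NormedAddCommGroup F] [NormedSpace ℝ F]
  {E : M → Type*} [∀ x, NormedAddCommGroup (E x)] [∀ x, InnerProductSpace ℝ (E x)]
  [TopologicalSpace (TotalSpace F E)] [FiberBundle F E] [VectorBundle ℝ F E]
  [ContMDiffVectorBundle ∞ F E (𝓡 n)] [IsContinuousRiemannianBundle F E]

local notation "𝔼" => EuclideanSpace ℝ (Fin n)

variable (n F E) in
/-- Locally, the pairing of a section of the dual bundle with a vector is controlled by the local
representative of the section and the norm of the vector. -/
theorem exists_eventually_norm_dual_apply_le (p : M) : ∃ C : ℝ, 0 < C ∧ ∀ᶠ x in 𝓝 p,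
    ∀ (φ : ∀ x, Dual E x) (w : E x), |(φ x w : ℝ)| ≤
      ‖localRep (F →L[ℝ] ℝ) (Dual E) p φ (chartAt 𝔼 p x)‖ * (C * ‖w‖) := by
  obtain ⟨C, hC, h⟩ := eventually_norm_trivializationAt_lt F E p
  refine ⟨C, hC, ?_⟩
  filter_upwards [h, (isOpen_patch (n := n) F E p).mem_nhds (mem_patch F E p)] with x hx hxp φ w
  classical
  -- The pairing formula concerns sections, so `w` is extended to one; no regularity is needed.
  obtain ⟨v, rfl⟩ : ∃ v : ∀ z, E z, v x = w := ⟨Function.update 0 x w, by simp⟩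
  have h1 := localRep_dual_apply (n := n) hxp φ v
  rw [localRep_chart hxp.1 v] at h1
  rw [← h1, ← Real.norm_eq_abs]
  refine (ContinuousLinearMap.le_opNorm _ _).trans ?_
  gcongr
  have h2 := ((trivializationAt F E p).continuousLinearMapAt ℝ x).le_of_opNorm_le hx.le (v x)
  rwa [Trivialization.continuousLinearMapAt_apply_of_mem (R := ℝ) (trivializationAt F E p) hxp.2] at h2

theorem continuousOn_norm_section {Ω : Set M} {v : ∀ x, E x} (hv : IsSmoothOn (n := n) F E Ω v) :
    ContinuousOn (fun x => ‖v x‖) Ω := by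
  have h := (hv.continuousOn.inner_bundle (F := F) hv.continuousOn).sqrt
  refine h.congr fun x _ => ?_
  exact norm_eq_sqrt_real_inner _

/-- Test sections of the dual bundle are bounded. -/
theorem exists_norm_dual_apply_le (φ : ∀ x, Dual E x)
    (hφ : IsSmoothOn (n := n) (F →L[ℝ] ℝ) (Dual E) univ φ) {K : Set M} (hK : IsCompact K) :
    ∃ B : ℝ, 0 ≤ B ∧ ∀ x ∈ K, ∀ w : E x, |(φ x w : ℝ)| ≤ B * ‖w‖ := by
  refine hK.induction_on (p := fun s => ∃ B : ℝ, 0 ≤ B ∧ ∀ x ∈ s, ∀ w : E x,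
    |(φ x w : ℝ)| ≤ B * ‖w‖) ⟨0, le_rfl, by simp⟩ ?_ ?_ fun p _ => ?_
  · rintro s t hst ⟨B, hB, h⟩
    exact ⟨B, hB, fun x hx => h x (hst hx)⟩
  · rintro s t ⟨B, hB, h⟩ ⟨B', hB', h'⟩
    refine ⟨max B B', le_max_of_le_left hB, fun x hx w => ?_⟩
    rcases hx with hx | hx
    · exact (h x hx w).trans (by gcongr; exact le_max_left _ _)
    · exact (h' x hx w).trans (by gcongr; exact le_max_right _ _)
  · obtain ⟨C, hC, h⟩ := exists_eventually_norm_dual_apply_le n F E p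
    have hU := isOpen_patch (n := n) (F →L[ℝ] ℝ) (Dual E) p
    have hpU := mem_patch (n := n) (F →L[ℝ] ℝ) (Dual E) p
    have h2 := contDiffOn_localRep hφ p hU subset_rfl (subset_univ _)
    have hcont : ContinuousAt
        (fun x => ‖localRep (F →L[ℝ] ℝ) (Dual E) p φ (chartAt 𝔼 p x)‖) p :=
      (ContinuousAt.comp (f := chartAt 𝔼 p) (h2.continuousOn.continuousAt
        ((isOpen_chart_image hU fun x hx => hx.1).mem_nhds (mem_image_of_mem _ hpU)))
        ((chartAt 𝔼 p).continuousAt (mem_chart_source 𝔼 p))).norm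
    set b := ‖localRep (F →L[ℝ] ℝ) (Dual E) p φ (chartAt 𝔼 p p)‖
    have hb := hcont.eventually_lt (continuousAt_const (y := b + 1)) (by simp [b])
    refine ⟨_, mem_nhdsWithin_of_mem_nhds (h.and hb), (b + 1) * C, by positivity,
      fun x hx w => (hx.1 φ w).trans ?_⟩
    rw [mul_assoc]
    gcongr
    exact hx.2.le

/-- Convergent sequences of test sections of the dual bundle tend to zero uniformly on compact
sets. -/
theorem eventually_norm_dual_apply_le {Ω : Set M}
    {φ : ℕ → testSections (n := n) (F →L[ℝ] ℝ) (Dual E) Ω}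
    (hφ : TestTendstoZero (F →L[ℝ] ℝ) (Dual E) Ω φ) {K : Set M} (hK : IsCompact K) {ε : ℝ}
    (hε : 0 < ε) : ∀ᶠ i in atTop, ∀ x ∈ K, ∀ w : E x, |((φ i).1 x w : ℝ)| ≤ ε * ‖w‖ := by
  have := ChartedSpace.locallyCompactSpace 𝔼 M
  refine hK.induction_on (p := fun s => ∀ᶠ i in atTop, ∀ x ∈ s, ∀ w : E x,
    |((φ i).1 x w : ℝ)| ≤ ε * ‖w‖) (by simp) ?_ ?_ fun p _ => ?_
  · intro s t hst h
    filter_upwards [h] with i hi x hx using hi x (hst hx)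
  · intro s t hs ht
    filter_upwards [hs, ht] with i hi hi' x hx using hx.elim (hi x) (hi' x)
  · obtain ⟨C, hC, h⟩ := exists_eventually_norm_dual_apply_le n F E p
    have hn := inter_mem h ((isOpen_patch (n := n) (F →L[ℝ] ℝ) (Dual E) p).mem_nhds
      (mem_patch _ _ p))
    -- Convergence of test sections gives uniform smallness only on the images of compact subsets of
    -- a patch, so a compact neighbourhood of `p` is chosen. The threshold `ε / C` compensates the
    -- constant of the norm comparison.
    obtain ⟨A, hA, hAn, hAc⟩ := local_compact_nhds hn
    refine ⟨A, mem_nhdsWithin_of_mem_nhds hA, ?_⟩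
    have h0 := hφ.2 p A (fun x hx => (hAn hx).2) hAc 0
    filter_upwards [Metric.tendstoUniformlyOn_iff.1 h0 (ε / C) (by positivity)] with i hi x hx w
    have h1 := hi _ (mem_image_of_mem _ hx)
    rw [Pi.zero_apply, dist_zero_left, norm_iteratedFDeriv_zero] at h1
    refine ((hAn hx).1 _ w).trans ?_
    calc _ ≤ ε / C * (C * ‖w‖) := by gcongr
      _ = ε * ‖w‖ := by field_simp

variable [MeasurableSpace M] [BorelSpace M] {vol : Measure M}

/-- Used twice: for the continuity of the functional defined by `u`, and for the estimate near `S`.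
Neither `A` nor `u` has to be measurable, since `lintegral_indicator_le` and the finiteness of the
constant suffice. -/
theorem enorm_setIntegral_dual_apply_le {Ω A : Set M} (hΩ : MeasurableSet Ω) {φ : ∀ x, Dual E x}
    {u : ∀ x, E x} {B : ℝ} (hB : ∀ x ∈ A, ∀ w : E x, |(φ x w : ℝ)| ≤ B * ‖w‖)
    (hA : ∀ x ∈ Ω, x ∉ A → φ x = 0) :
    ∫⁻ x in Ω, ‖(φ x (u x) : ℝ)‖ₑ ∂vol ≤ ENNReal.ofReal B * ∫⁻ x in A, ‖u x‖ₑ ∂vol := by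
  rw [← lintegral_const_mul' _ _ ENNReal.ofReal_ne_top, ← lintegral_indicator hΩ]
  refine (lintegral_mono fun x => ?_).trans (lintegral_indicator_le _ A)
  by_cases hx : x ∈ Ω
  · rw [indicator_of_mem hx]
    by_cases hxA : x ∈ A
    · rw [indicator_of_mem hxA]
      have hB0 : 0 ≤ B * ‖u x‖ := (abs_nonneg _).trans (hB x hxA (u x))
      rw [Real.enorm_eq_ofReal_abs, ← ofReal_norm, ← ENNReal.ofReal_mul' (norm_nonneg _)]
      exact ENNReal.ofReal_le_ofReal (hB x hxA (u x))
    · rw [hA x hx hxA]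
      simp
  · rw [indicator_of_notMem hx]
    exact zero_le

/-- A section that is smooth on an open set and locally integrable up to its boundary
defines a distributional section of `E` over `M`. -/
theorem exists_distSection_setIntegral {Ω : Set M} (hΩ : IsOpen Ω) {u : ∀ x, E x}
    (hu : IsSmoothOn (n := n) F E Ω u)
    (hfin : ∀ K : Set M, IsCompact K → ∫⁻ x in K ∩ Ω, ‖u x‖ₑ ∂vol ≠ ⊤) :
    ∃ T : DistSection n F E univ, ∀ φ, T.eval φ = ∫ x in Ω, (φ.1 x (u x) : ℝ) ∂vol := by
  have hle (φ : testSections (n := n) (F →L[ℝ] ℝ) (Dual E) univ) {K : Set M}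
      (hK : sectionSupport ⇑φ.1 ⊆ K) {B : ℝ} (hB : ∀ x ∈ K, ∀ w : E x, |(φ.1 x w : ℝ)| ≤ B * ‖w‖) :
      ∫⁻ x in Ω, ‖(φ.1 x (u x) : ℝ)‖ₑ ∂vol ≤ ENNReal.ofReal B * ∫⁻ x in K ∩ Ω, ‖u x‖ₑ ∂vol :=
    enorm_setIntegral_dual_apply_le hΩ.measurableSet (fun x hx => hB x hx.1) fun x hx hxK =>
      eq_zero_of_notMem_sectionSupport fun h => hxK ⟨hK h, hx⟩
  have hint (φ : testSections (n := n) (F →L[ℝ] ℝ) (Dual E) univ) :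
      Integrable (fun x => (φ.1 x (u x) : ℝ)) (vol.restrict Ω) := by
    have hsm := isSmoothOn_of_contMDiffSection φ.1 Ω
    refine ⟨ContinuousOn.aestronglyMeasurable (fun x hx =>
      (continuousAt_dual_apply hΩ hsm hu hx).continuousWithinAt) hΩ.measurableSet, ?_⟩
    obtain ⟨B, -, hB⟩ := exists_norm_dual_apply_le _ (isSmoothOn_of_contMDiffSection φ.1 univ) φ.2.1
    exact (hle φ subset_rfl hB).trans_lt
      (ENNReal.mul_lt_top ENNReal.ofReal_lt_top (hfin _ φ.2.1).lt_top)
  refine ⟨⟨⟨⟨fun φ => ∫ x in Ω, (φ.1 x (u x) : ℝ) ∂vol, fun φ ψ => ?_⟩, fun c φ => ?_⟩,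
    fun φ hφ => ?_⟩, fun φ => rfl⟩
  · exact integral_add (hint φ) (hint ψ)
  · exact integral_const_mul c _
  · obtain ⟨⟨K, -, hK, hφK⟩, -⟩ := id hφ
    set I := ∫⁻ x in K ∩ Ω, ‖u x‖ₑ ∂vol
    rw [Metric.tendsto_atTop']
    intro ε hε
    -- The summand `1` keeps the denominator positive when the integral `I` vanishes.
    have hpos : 0 < ε / (I.toReal + 1) := by positivity
    obtain ⟨N, hN⟩ := eventually_atTop.1 (eventually_norm_dual_apply_le hφ hK hpos)
    refine ⟨N, fun i hi => ?_⟩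
    have h1 := (enorm_integral_le_lintegral_enorm _).trans (hle (φ i) (hφK i) (hN i hi.le))
    have h2 := ENNReal.toReal_mono
      (ENNReal.mul_ne_top ENNReal.ofReal_ne_top (hfin K hK)) h1
    rw [ENNReal.toReal_mul, ENNReal.toReal_ofReal hpos.le, toReal_enorm] at h2
    rw [dist_zero_right]
    refine h2.trans_lt ?_
    rw [div_mul_eq_mul_div, div_lt_iff₀ (by positivity)]
    have : 0 ≤ I.toReal := ENNReal.toReal_nonneg
    change ε * I.toReal < _
    nlinarith

end Integrable

/-! ### Local integrability up to `S` -/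

section LocallyIntegrable

variable {n : ℕ} {M : Type*} [EMetricSpace M] [ChartedSpace (EuclideanSpace ℝ (Fin n)) M]
  [IsManifold (𝓡 n) ∞ M]
  {F : Type*} [NormedAddCommGroup F] [NormedSpace ℝ F]
  {E : M → Type*} [∀ x, NormedAddCommGroup (E x)] [∀ x, InnerProductSpace ℝ (E x)]
  [TopologicalSpace (TotalSpace F E)] [FiberBundle F E] [VectorBundle ℝ F E]
  [ContMDiffVectorBundle ∞ F E (𝓡 n)] [IsContinuousRiemannianBundle F E]
  [MeasurableSpace M] [BorelSpace M] {vol : Measure M} [IsFiniteMeasureOnCompacts vol]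

/-- Integrability near `S` implies local integrability. -/
theorem lintegral_enorm_ne_top {S : Set M} {u : ∀ x, E x} (hu : IsSmoothOn (n := n) F E Sᶜ u)
    {K : Set M} (hK : IsCompact K) {r : ℝ} (hr : 0 < r)
    (h : ∫⁻ x in puncturedNbhd S r ∩ K, ‖u x‖ₑ ∂vol ≠ ⊤) :
    ∫⁻ x in K ∩ Sᶜ, ‖u x‖ₑ ∂vol ≠ ⊤ := by
  -- The points of `K` at distance at least `r` from `S` form a compact set disjoint from `S`, on
  -- which `‖u‖` is continuous and hence bounded. The rest of `K` off `S` lies in the punctured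
  -- neighbourhood.
  set K' := K ∩ {x | ENNReal.ofReal r ≤ Metric.infEDist x S}
  have hK' : IsCompact K' :=
    hK.inter_right (isClosed_le continuous_const Metric.continuous_infEDist)
  have hK'S : K' ⊆ Sᶜ := fun x hx hxS => by
    have h1 : ENNReal.ofReal r ≤ 0 := hx.2.trans (Metric.infEDist_zero_of_mem hxS).le
    simp [hr.not_ge] at h1
  obtain ⟨C, hC⟩ := hK'.exists_bound_of_continuousOn ((continuousOn_norm_section hu).mono hK'S)
  have h2 : ∫⁻ x in K', ‖u x‖ₑ ∂vol ≠ ⊤ := by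
    refine ((setLIntegral_mono' hK'.measurableSet (g := fun _ => ENNReal.ofReal C)
      fun x hx => ?_).trans_lt ?_).ne
    · rw [← ofReal_norm]
      exact ENNReal.ofReal_le_ofReal ((norm_norm (u x)).symm.trans_le (hC x hx))
    · rw [setLIntegral_const]
      exact ENNReal.mul_lt_top ENNReal.ofReal_lt_top hK'.measure_lt_top
  refine ((lintegral_mono_set (t := (puncturedNbhd S r ∩ K) ∪ K') fun x hx => ?_).trans_lt
    ((lintegral_union_le _ _ _).trans_lt (ENNReal.add_lt_top.2 ⟨h.lt_top, h2.lt_top⟩))).ne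
  rcases le_total (Metric.infEDist x S) (ENNReal.ofReal r) with hle | hle
  · exact Or.inl ⟨⟨hle, hx.2⟩, hx.1⟩
  · exact Or.inr ⟨hx.1, hle⟩

end LocallyIntegrable

/-! ### Riemannian distance and distance in charts -/

section RiemannianDistance

open Metric

variable {E : Type*} [NormedAddCommGroup E] [NormedSpace ℝ E]
  {H : Type*} [TopologicalSpace H] (I : ModelWithCorners ℝ E H)
  {M : Type*} [TopologicalSpace M] [ChartedSpace H M]
  [RiemannianBundle (fun x : M => TangentSpace I x)] [IsManifold I 1 M]
  [IsContinuousRiemannianBundle E (fun x : M => TangentSpace I x)]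

/-- The inverses of the preferred charts have locally bounded derivatives. -/
theorem exists_eventually_enorm_mfderivWithin_symm_extChartAt_le (p : M) :
    ∃ C : NNReal, 0 < C ∧ ∀ᶠ y in 𝓝[range I] (extChartAt I p p), ∀ w : E,
      ‖(mfderivWithin 𝓘(ℝ, E) I (extChartAt I p).symm (range I) y w :
        TangentSpace I ((extChartAt I p).symm y))‖ₑ ≤ C * ‖w‖ₑ := by
  obtain ⟨C, C_pos, hC⟩ :=
    eventually_norm_symmL_trivializationAt_lt E (fun x : M => TangentSpace I x) p
  lift C to NNReal using C_pos.le
  refine ⟨C, by exact_mod_cast C_pos, ?_⟩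
  have hnhds : 𝓝 p = 𝓝 ((extChartAt I p).symm (extChartAt I p p)) := by
    rw [extChartAt_to_inv]
  rw [hnhds] at hC
  have hcont : ContinuousAt (extChartAt I p).symm (extChartAt I p p) :=
    continuousAt_extChartAt_symm _
  have hsrc := hnhds ▸ chart_source_mem_nhds H p
  filter_upwards [nhdsWithin_le_nhds (hcont.preimage_mem_nhds (inter_mem hC hsrc)),
    extChartAt_target_mem_nhdsWithin p] with y hy hyt w
  have h := TangentBundle.symmL_trivializationAt (I := I) hy.2
  rw [(extChartAt I p).right_inv hyt] at h
  have h1 := ContinuousLinearMap.le_of_opNorm_le _ hy.1.le w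
  have h2 : ‖(trivializationAt E (fun x : M => TangentSpace I x) p).symmL ℝ
      ((extChartAt I p).symm y) w‖ₑ ≤ C * ‖w‖ₑ := by
    rw [← ofReal_norm, ← ofReal_norm, ← ENNReal.ofReal_coe_nnreal,
      ← ENNReal.ofReal_mul C.coe_nonneg]
    exact ENNReal.ofReal_le_ofReal h1
  exact (congrArg (fun v : TangentSpace I ((extChartAt I p).symm y) => ‖v‖ₑ)
    (DFunLike.congr_fun h w)).symm.trans_le h2

/-- The Riemannian distance is locally controlled by the distance in the preferred charts. -/
theorem exists_riemannianEDist_le_edist_extChartAt (p : M) :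
    ∃ C : NNReal, 0 < C ∧ ∃ U ∈ 𝓝 p, U ⊆ (chartAt H p).source ∧ ∀ x ∈ U, ∀ y ∈ U,
      riemannianEDist I x y ≤ C * edist (extChartAt I p x) (extChartAt I p y) := by
  obtain ⟨C, C_pos, hC⟩ := exists_eventually_enorm_mfderivWithin_symm_extChartAt_le I p
  obtain ⟨r, r_pos, hr⟩ :=
    mem_nhdsWithin_iff.1 (inter_mem (extChartAt_target_mem_nhdsWithin p) hC)
  have A : (extChartAt I p) ⁻¹' (ball (extChartAt I p p) r ∩ range I) ∈ 𝓝 p := by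
    apply extChartAt_preimage_mem_nhds_of_mem_nhdsWithin (by simp)
    rw [inter_comm]
    exact inter_mem_nhdsWithin _ (ball_mem_nhds _ r_pos)
  refine ⟨C, C_pos, _, inter_mem A (chart_source_mem_nhds H p), inter_subset_right, ?_⟩
  rintro x ⟨hx, h'x⟩ y ⟨hy, h'y⟩
  -- The comparison path is the image of the straight segment in the chart. By convexity the segment
  -- stays where the derivative of the inverse chart is bounded by `C`, so the path is at most `C`
  -- times as long as the segment.
  let η := ContinuousAffineMap.lineMap (R := ℝ) (extChartAt I p x) (extChartAt I p y)
  set γ := (extChartAt I p).symm ∘ η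
  have hη : Icc 0 1 ⊆ ⇑η ⁻¹' (ball (extChartAt I p p) r ∩ range I) := by
    simp only [← image_subset_iff, ContinuousAffineMap.coe_lineMap_eq,
      ← segment_eq_image_lineMap, η]
    exact ((convex_ball _ _).inter I.convex_range).segment_subset hx hy
  have hηt : Icc 0 1 ⊆ ⇑η ⁻¹' (extChartAt I p).target := fun t ht => (hr (hη ht)).1
  have η_smooth : ContMDiffOn 𝓘(ℝ, ℝ) 𝓘(ℝ, E) 1 η (Icc 0 1) := by
    apply ContMDiff.contMDiffOn
    rw [contMDiff_iff_contDiff]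
    exact ContinuousAffineMap.contDiff _
  have hlen : riemannianEDist I x y ≤ pathELength I γ 0 1 := by
    apply riemannianEDist_le_pathELength _ _ _ zero_le_one
    · exact (contMDiffOn_extChartAt_symm p).comp η_smooth hηt
    · simp [γ, η, ContinuousAffineMap.coe_lineMap_eq, h'x]
    · simp [γ, η, ContinuousAffineMap.coe_lineMap_eq, h'y]
  refine hlen.trans ?_
  rw [← lintegral_fderiv_lineMap_eq_edist, pathELength_eq_lintegral_mfderivWithin_Icc,
    ← lintegral_const_mul' _ _ ENNReal.coe_ne_top]
  refine setLIntegral_mono' measurableSet_Icc fun t ht => ?_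
  have hcomp : mfderivWithin 𝓘(ℝ, ℝ) I γ (Icc 0 1) t =
      (mfderivWithin 𝓘(ℝ, E) I (extChartAt I p).symm (range I) (η t)).comp
        (mfderivWithin 𝓘(ℝ, ℝ) 𝓘(ℝ, E) η (Icc 0 1) t) := by
    apply mfderivWithin_comp
    · exact mdifferentiableWithinAt_extChartAt_symm (hηt ht)
    · exact η_smooth.mdifferentiableOn one_ne_zero t ht
    · exact hηt.trans (preimage_mono (extChartAt_target_subset_range p))
    · rw [uniqueMDiffWithinAt_iff_uniqueDiffWithinAt]
      exact uniqueDiffOn_Icc zero_lt_one t ht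
  rw [hcomp]
  refine ((hr (hη ht)).2 _).trans ?_
  rw [mfderivWithin_eq_fderivWithin]
  exact le_of_eq rfl

end RiemannianDistance

/-! ### Geometry of embedded submanifolds -/

section Geometry

variable {n : ℕ} {M : Type*} [EMetricSpace M] [ChartedSpace (EuclideanSpace ℝ (Fin n)) M]
  [IsManifold (𝓡 n) ∞ M]

local notation "𝔼" => EuclideanSpace ℝ (Fin n)

/-- The complement of a submanifold of positive codimension is dense. -/
theorem IsEmbeddedSubmanifold.dense_compl {m : ℕ} {S : Set M} (hS : IsEmbeddedSubmanifold n m S)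
    (hm : 1 ≤ m) : Dense Sᶜ := by
  rw [← interior_eq_empty_iff_dense_compl]
  by_contra hne
  obtain ⟨p, hp⟩ := nonempty_iff_ne_empty.2 hne
  obtain ⟨c, -, hpc, W, hW, hWS⟩ := hS p (interior_subset hp)
  have hop : IsOpen (c '' (c.source ∩ interior S)) :=
    c.isOpen_image_source_inter isOpen_interior
  have hsub : c '' (c.source ∩ interior S) ⊆ W := by
    rintro _ ⟨x, hx, rfl⟩
    exact (hWS x hx.1).1 (interior_subset hx.2)
  -- A linear subspace with an interior point is the whole space, which forces the codimension to be
  -- `0`.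
  have htop := Submodule.eq_top_of_nonempty_interior' W
    ⟨c p, interior_maximal hsub hop (mem_image_of_mem _ ⟨hpc, hp⟩)⟩
  rw [htop, finrank_top, finrank_euclideanSpace_fin] at hW
  omega

theorem contDiffOn_transition {c c' : OpenPartialHomeomorph M 𝔼}
    (hc : c ∈ IsManifold.maximalAtlas (𝓡 n) ∞ M) (hc' : c' ∈ IsManifold.maximalAtlas (𝓡 n) ∞ M) :
    ContDiffOn ℝ ∞ (c ∘ c'.symm) (c'.target ∩ c'.symm ⁻¹' c.source) := by
  rw [← contMDiffOn_iff_contDiffOn]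
  exact (contMDiffOn_of_mem_maximalAtlas hc).comp
    ((contMDiffOn_symm_of_mem_maximalAtlas hc').mono inter_subset_left) inter_subset_right

/-- Around a point of a submanifold there is a smooth function that vanishes on the submanifold and
controls the distance from it. -/
theorem IsEmbeddedSubmanifold.exists_defining_function
    [RiemannianBundle (fun x : M => TangentSpace (𝓡 n) x)]
    [IsContinuousRiemannianBundle (EuclideanSpace ℝ (Fin n))
      (fun x : M => TangentSpace (𝓡 n) x)] [IsRiemannianManifold (𝓡 n) M]
    {m : ℕ} {S : Set M} (hS : IsEmbeddedSubmanifold n m S) {p : M} (hp : p ∈ S) :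
    ∃ η : 𝔼 → 𝔼, ContDiff ℝ ∞ η ∧ ∃ C : ℝ, 0 < C ∧ ∃ U : Set M, IsOpen U ∧ p ∈ U ∧
      (∀ x ∈ U, x ∈ S → η (chartAt 𝔼 p x) = 0) ∧
      ∀ x ∈ U, Metric.infEDist x S ≤ ENNReal.ofReal (C * ‖η (chartAt 𝔼 p x)‖) := by
  obtain ⟨C₁, hC₁, U₁, hU₁, hU₁s, hdist⟩ := exists_riemannianEDist_le_edist_extChartAt (𝓡 n) p
  obtain ⟨c, hc, hpc, W, -, hWS⟩ := hS p hp
  set e := chartAt 𝔼 p with he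
  have heA : e ∈ IsManifold.maximalAtlas (𝓡 n) ∞ M := IsManifold.chart_mem_maximalAtlas p
  have hpe : p ∈ e.source := mem_chart_source 𝔼 p
  have hcp : c p ∈ W := (hWS p hpc).1 hp
  -- the transition map from `c` to the preferred chart is Lipschitz
  have hop' : IsOpen (c.target ∩ c.symm ⁻¹' e.source) :=
    c.isOpen_inter_preimage_symm e.open_source
  have hmem' : c p ∈ c.target ∩ c.symm ⁻¹' e.source :=
    ⟨c.map_source hpc, by simpa [c.left_inv hpc] using hpe⟩
  obtain ⟨C₂, V, hV, hLip⟩ := (((contDiffOn_transition heA hc).contDiffAt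
    (hop'.mem_nhds hmem')).of_le (m := 1) (by norm_cast)).exists_lipschitzOnWith
  have hsymm : ContinuousAt c.symm (c p) := c.symm.continuousAt (c.map_source hpc)
  have hU₁' : c.symm ⁻¹' U₁ ∈ 𝓝 (c p) :=
    hsymm.preimage_mem_nhds (by rw [c.left_inv hpc]; exact hU₁)
  obtain ⟨δ, hδ, hball⟩ := Metric.mem_nhds_iff.1
    (inter_mem (inter_mem hV hU₁') (c.open_target.mem_nhds (c.map_source hpc)))
  -- the defining function
  have hop : IsOpen (e.target ∩ e.symm ⁻¹' c.source) :=
    e.isOpen_inter_preimage_symm c.open_source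
  have hmem : e p ∈ e.target ∩ e.symm ⁻¹' c.source :=
    ⟨e.map_source hpe, by simpa [e.left_inv hpe] using hpc⟩
  have hg := contDiffOn_transition hc heA
  obtain ⟨b, hbt, hbc, hbs, -, hb1⟩ := exists_contDiff_tsupport_subset (n := (⊤ : ℕ∞))
    (hop.mem_nhds hmem)
  -- In the flattening chart `c` the component orthogonal to `W` vanishes exactly on `W`. It is
  -- written in the preferred chart, where the local adjoint is computed, and multiplied by the bump
  -- `b` to become smooth on the whole space.
  have hgb : ContDiff ℝ ∞ fun y => b y • Wᗮ.starProjection (c (e.symm y)) := by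
    refine contDiff_of_tsupport fun y hy => ?_
    have hy' := hbt (tsupport_smul_subset_left b _ hy)
    exact hbs.contDiffAt.smul
      (Wᗮ.starProjection.contDiff.contDiffAt.comp y (hg.contDiffAt (hop.mem_nhds hy')))
  have hb : ∀ᶠ x in 𝓝 p, 1 / 2 < b (e x) := by
    have h : ContinuousAt (fun x => b (e x)) p :=
      ContinuousAt.comp (f := e) hbs.continuous.continuousAt (e.continuousAt hpe)
    exact h.eventually (lt_mem_nhds (by beta_reduce; rw [hb1]; norm_num))
  have hcball : c ⁻¹' Metric.ball (c p) δ ∈ 𝓝 p :=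
    (c.continuousAt hpc).preimage_mem_nhds (Metric.ball_mem_nhds _ hδ)
  obtain ⟨U, hUsub, hU, hpU⟩ := mem_nhds_iff.1 (inter_mem (inter_mem (inter_mem hb hcball) hU₁)
    (c.open_source.mem_nhds hpc))
  -- The factor `2` compensates `b > 1 / 2`, `C₁` compares Riemannian with chart distance, `C₂` is
  -- the Lipschitz constant of the transition map, and the summand `1` gives positivity even if `C₂
  -- = 0`.
  refine ⟨_, hgb, 2 * (C₁ * C₂) + 1, by positivity, U, hU, hpU, fun x hx hxS => ?_, fun x hx => ?_⟩
  · have hxc := (hUsub hx).2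
    have hxe := hU₁s (hUsub hx).1.2
    have hxW := (hWS x hxc).1 hxS
    simp only [e.left_inv hxe]
    rw [Submodule.starProjection_orthogonal_apply_eq_zero hxW, smul_zero]
  · obtain ⟨⟨⟨hbx, hxδ⟩, hxU₁⟩, hxc⟩ := hUsub hx
    have hxe := hU₁s hxU₁
    -- The distance from `S` is bounded by the distance to `c.symm z`. Projecting does not increase
    -- the distance from `c p`, because `c p ∈ W`; hence `z` stays in the ball where all estimates
    -- hold.
    set z := W.starProjection (c x) with hz
    have hzW : z ∈ W := W.starProjection_apply_mem _
    have hxz : c x - z = Wᗮ.starProjection (c x) := (W.starProjection_orthogonal_val (c x)).symm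
    have hzδ : z ∈ Metric.ball (c p) δ := by
      rw [mem_ball_iff_norm]
      have h1 : z - c p = W.starProjection (c x - c p) := by
        rw [map_sub, W.starProjection_eq_self_iff.2 hcp]
      rw [h1]
      exact (W.norm_starProjection_apply_le _).trans_lt (mem_ball_iff_norm.1 hxδ)
    obtain ⟨⟨hzV, hzU₁⟩, hzc⟩ := hball hzδ
    have hyS : c.symm z ∈ S := (hWS _ (c.map_target hzc)).2 (by rwa [c.right_inv hzc])
    have h2 : edist x (c.symm z) ≤ C₁ * (C₂ * edist (c x) z) := by
      rw [IsRiemannianManifold.out (I := 𝓡 n) x (c.symm z)]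
      refine (hdist x hxU₁ _ hzU₁).trans ?_
      gcongr
      have h3 := hLip (hball hxδ).1.1 hzV
      simpa [c.left_inv hxc] using h3
    refine (Metric.infEDist_le_edist_of_mem hyS).trans (h2.trans ?_)
    rw [edist_dist, dist_eq_norm, hxz, ← ENNReal.ofReal_coe_nnreal, ← ENNReal.ofReal_coe_nnreal,
      ← ENNReal.ofReal_mul (by positivity), ← ENNReal.ofReal_mul (by positivity)]
    refine ENNReal.ofReal_le_ofReal ?_
    simp only [e.left_inv hxe]
    rw [norm_smul, Real.norm_of_nonneg (one_half_pos.le.trans hbx.le)]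
    set N := ‖Wᗮ.starProjection (c x)‖
    have hN : 0 ≤ N := norm_nonneg _
    have h4 : N ≤ 2 * (b (e x) * N) := by nlinarith [hbx.out]
    calc (C₁ : ℝ) * (C₂ * N) ≤ C₁ * (C₂ * (2 * (b (e x) * N))) := by gcongr
      _ ≤ (2 * (C₁ * C₂) + 1) * (b (e x) * N) := by nlinarith

end Geometry

/-! ### The cutoff function -/

section Cutoff

/-- A smooth function that is `1` near the origin and vanishes far away, with bounded
derivatives. -/
theorem exists_contDiff_cutoff (W : Type*) [NormedAddCommGroup W] [InnerProductSpace ℝ W]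
    [FiniteDimensional ℝ W] (k : ℕ) :
    ∃ χ : W → ℝ, ContDiff ℝ ∞ χ ∧ (∀ z, ‖z‖ ≤ 1 → χ z = 1) ∧ (∀ z, 2 ≤ ‖z‖ → χ z = 0) ∧
      ∃ C : ℝ, ∀ j ≤ k, ∀ z, ‖iteratedFDeriv ℝ j χ z‖ ≤ C := by
  let χ : ContDiffBump (0 : W) := ⟨1, 2, one_pos, one_lt_two⟩
  have hχ : ContDiff ℝ ∞ χ := χ.contDiff
  obtain ⟨C, hC1, hC⟩ := exists_norm_iteratedFDeriv_le hχ k χ.hasCompactSupport.isCompact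
  refine ⟨χ, hχ, fun z hz => χ.one_of_mem_closedBall (by simpa using hz),
    fun z hz => χ.zero_of_le_dist (by simpa using hz), C, fun j hj z => ?_⟩
  by_cases hz : z ∈ tsupport χ
  · exact hC j hj z hz
  · rw [Function.notMem_support.1 fun h => hz (support_iteratedFDeriv_subset (𝕜 := ℝ) j h), norm_zero]
    exact zero_le_one.trans hC1

end Cutoff

/-! ### The equation across `S` -/

section Extension

variable {n : ℕ} {M : Type*} [EMetricSpace M] [SecondCountableTopology M]
  [ChartedSpace (EuclideanSpace ℝ (Fin n)) M] [IsManifold (𝓡 n) ∞ M]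
  [MeasurableSpace M] [BorelSpace M] {vol : Measure M}
  {F : Type*} [NormedAddCommGroup F] [NormedSpace ℝ F]
  {E : M → Type*} [∀ x, NormedAddCommGroup (E x)] [∀ x, InnerProductSpace ℝ (E x)]
  [TopologicalSpace (TotalSpace F E)] [FiberBundle F E] [VectorBundle ℝ F E]
  [ContMDiffVectorBundle ∞ F E (𝓡 n)] [IsContinuousRiemannianBundle F E]
  {F' : Type*} [NormedAddCommGroup F'] [NormedSpace ℝ F']
  {E' : M → Type*} [∀ x, AddCommGroup (E' x)] [∀ x, Module ℝ (E' x)]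
  [∀ x, TopologicalSpace (E' x)]
  [TopologicalSpace (TotalSpace F' E')] [FiberBundle F' E'] [VectorBundle ℝ F' E']
  [ContMDiffVectorBundle ∞ F' E' (𝓡 n)] [SigmaCompactSpace M]
  {k : ℕ} {L : Cₛ^∞⟮𝓡 n; F, E⟯ →ₗ[ℝ] Cₛ^∞⟮𝓡 n; F', E'⟯}

local notation "𝔼" => EuclideanSpace ℝ (Fin n)

/-- Smooth sections that agree on a dense set are equal. -/
theorem eq_of_dense {v w : ∀ x, E x} (hv : IsSmoothOn (n := n) F E univ v)
    (hw : IsSmoothOn (n := n) F E univ w) {A : Set M} (hA : Dense A)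
    (h : ∀ x ∈ A, v x = w x) : v = w := by
  let s : Cₛ^∞⟮𝓡 n; F, E⟯ := ⟨v, contMDiffOn_univ.1 hv⟩ - ⟨w, contMDiffOn_univ.1 hw⟩
  have hs (x : M) : s x = v x - w x := rfl
  have hcont : Continuous fun x => ‖s x‖ :=
    continuousOn_univ.1 (continuousOn_norm_section (isSmoothOn_of_contMDiffSection s univ))
  have h0 := hcont.ext_on hA continuous_const fun x hx => show ‖s x‖ = 0 by
    rw [hs, h x hx, sub_self, norm_zero]
  funext x
  have h1 := congrFun h0 x
  rwa [hs, norm_eq_zero, sub_eq_zero] at h1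

theorem setIntegral_dual_apply_eq {Ω : Set M}
    (φ : testSections (n := n) (F →L[ℝ] ℝ) (Dual E) Ω) (u : ∀ x, E x) :
    ∫ x in Ω, (φ.1 x (u x) : ℝ) ∂vol = ∫ x, (φ.1 x (u x) : ℝ) ∂vol :=
  setIntegral_eq_integral_of_forall_compl_eq_zero fun x hx => by
    rw [eq_zero_of_notMem_sectionSupport fun h => hx (φ.2.2 h)]
    rfl

/-- A distributional section over `M` given by a solution over `Ω` is annihilated by the operator
over `Ω`. -/
theorem eval_formalDual_eq_zero_of_subset (hL : IsDiffOp k L)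
    (hvol : IsSmoothPositiveDensity n vol) {Ω : Set M} {u : ∀ x, E x} (hu : u ∈ solutions vol L Ω)
    {T : DistSection n F E univ} (hT : ∀ φ, T.eval φ = ∫ x in Ω, (φ.1 x (u x) : ℝ) ∂vol)
    (φ : testSections (n := n) (F' →L[ℝ] ℝ) (Dual E') univ) (hφ : sectionSupport ⇑φ.1 ⊆ Ω) :
    T.eval (formalDual vol L univ φ) = 0 := by
  obtain ⟨T₀, hT₀, h0⟩ := hu
  let φ' : testSections (n := n) (F' →L[ℝ] ℝ) (Dual E') Ω := ⟨φ.1, φ.2.1, hφ⟩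
  have h1 : T₀.eval (formalDual vol L Ω φ') = 0 := LinearMap.congr_fun h0 φ'
  rw [hT₀.2] at h1
  -- The formal duals over `Ω` and over `M` agree on a test section supported in `Ω`, and the result
  -- is still supported in `Ω`.
  rw [hT, formalDual_congr hL hvol φ φ' rfl, setIntegral_dual_apply_eq, h1]

variable [RiemannianBundle (fun x : M => TangentSpace (𝓡 n) x)]
  [IsContinuousRiemannianBundle (EuclideanSpace ℝ (Fin n))
    (fun x : M => TangentSpace (𝓡 n) x)] [IsRiemannianManifold (𝓡 n) M]

/-- If the mean of `u` near `S` decays faster than `rᵏ`, then the distributional section given by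
`u` is annihilated by the operator of order `k` near the points of `S`. -/
theorem exists_nhds_eval_formalDual_eq_zero (hL : IsDiffOp k L)
    (hvol : IsSmoothPositiveDensity n vol) {m : ℕ} {S : Set M} (hSclosed : IsClosed S)
    (hS : IsEmbeddedSubmanifold n m S) {u : ∀ x, E x} (hu : u ∈ solutions vol L Sᶜ)
    (hsmall : ∀ K : Set M, IsCompact K → ∀ ε : ℝ, 0 < ε → ∀ᶠ r : ℝ in 𝓝[>] 0,
      ∫⁻ x in puncturedNbhd S r ∩ K, ‖u x‖ₑ ∂vol ≤ ENNReal.ofReal (ε * r ^ k))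
    {T : DistSection n F E univ} (hT : ∀ φ, T.eval φ = ∫ x in Sᶜ, (φ.1 x (u x) : ℝ) ∂vol)
    {p : M} (hp : p ∈ S) :
    ∃ V ∈ 𝓝 p, ∀ φ : testSections (n := n) (F' →L[ℝ] ℝ) (Dual E') univ,
      sectionSupport ⇑φ.1 ⊆ V → T.eval (formalDual vol L univ φ) = 0 := by
  obtain ⟨η, hη, C, hC, U, hU, hpU, hηS, hηd⟩ := hS.exists_defining_function hp
  obtain ⟨C', hC', hpair⟩ := exists_eventually_norm_dual_apply_le n F E p
  obtain ⟨D⟩ := nonempty_localData hL hvol p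
  obtain ⟨χ, hχ, hχ1, hχ0, C₀, hC₀⟩ := exists_contDiff_cutoff 𝔼 k
  have hjoint := (isOpen_jointPatch (n := n) (F := F) (E := E) (F' := F') (E' := E') p).mem_nhds
    ⟨mem_patch F E p, mem_patch F' E' p⟩
  refine ⟨_, inter_mem (inter_mem (hU.mem_nhds hpU) hpair) hjoint, fun φ hφ => ?_⟩
  set K := sectionSupport ⇑φ.1
  have hK : IsCompact K := φ.2.1
  have hKs : ∀ x ∈ K, x ∈ (chartAt 𝔼 p).source := fun x hx => (hφ hx).2.1.1
  have hKp : K ⊆ patch (n := n) (F' →L[ℝ] ℝ) (Dual E') p := fun x hx => by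
    rw [patch_dual]
    exact (hφ hx).2.2
  set f := extendedRep (n := n) (F' →L[ℝ] ℝ) (Dual E') p φ.1
  have hft : tsupport f ⊆ chartAt 𝔼 p '' K := tsupport_extendedRep_subset hK hKp
  have hfU : tsupport f ⊆ chartAt 𝔼 p '' jointPatch n F E F' E' p :=
    hft.trans (image_mono fun x hx => (hφ hx).2)
  have hfc : HasCompactSupport f := hasCompactSupport_extendedRep hK hKp
  have hfs : ContDiff ℝ ∞ f :=
    contDiff_extendedRep (isSmoothOn_of_contMDiffSection φ.1 univ) hK hKp
  have hfφ (x : M) : sectionOfLocal (Dual E') p f x = φ.1 x := sectionOfLocal_extendedRep hKp x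
  obtain ⟨B, hB0, hB⟩ := exists_norm_localAdjoint_rescaled_le LocalData.isOpen_image
    (D.contDiffOn_density.mono LocalData.image_subset_target)
    (fun y hy => D.density_pos y (LocalData.image_subset_target hy)) D.contDiffOn_coeff hfs hfc hfU
    hχ hC₀ hη
  -- points of the support of the local representative
  have hmemK {x : M} (hx : x ∈ (chartAt 𝔼 p).source) (hxt : chartAt 𝔼 p x ∈ tsupport f) :
      x ∈ K := by
    obtain ⟨z, hz, hzx⟩ := hft hxt
    exact (chartAt 𝔼 p).injOn (hKs z hz) hx hzx ▸ hz
  -- the estimate for fixed `r`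
  have key (r : ℝ) (hr : 0 < r) (hr1 : r ≤ 1) : ‖T.eval (formalDual vol L univ φ)‖ₑ ≤
      ENNReal.ofReal (B * (r⁻¹) ^ k * C') *
        ∫⁻ x in puncturedNbhd S (C * (2 * r)) ∩ K, ‖u x‖ₑ ∂vol := by
    set fr : 𝔼 → (F' →L[ℝ] ℝ) := fun z => χ (r⁻¹ • η z) • f z
    have hηr : ContDiff ℝ ∞ fun z => r⁻¹ • η z := hη.const_smul r⁻¹
    have hfrs : ContDiff ℝ ∞ fr := (hχ.comp hηr).smul hfs
    have hfrt : tsupport fr ⊆ tsupport f := tsupport_smul_subset_right _ _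
    have hfrc : HasCompactSupport fr := hfc.of_isClosed_subset (isClosed_tsupport _) hfrt
    have hfrU := hfrt.trans hfU
    have hfrp : tsupport fr ⊆ chartAt 𝔼 p '' patch (n := n) (F' →L[ℝ] ℝ) (Dual E') p :=
      (hfrt.trans hft).trans (image_mono hKp)
    set φr : testSections (n := n) (F' →L[ℝ] ℝ) (Dual E') univ :=
      testSectionOfLocal p fr hfrs hfrc hfrp (subset_univ _)
    have hφr (x : M) : φr.1 x = sectionOfLocal (Dual E') p fr x := rfl
    have hφrK : sectionSupport ⇑φr.1 ⊆ K := by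
      refine (sectionSupport_sectionOfLocal_subset hfrc (fun _ hx => hx.1) hfrp).trans ?_
      rintro _ ⟨y, hy, rfl⟩
      obtain ⟨x, hx, rfl⟩ := hft (hfrt hy)
      rwa [(chartAt 𝔼 p).left_inv (hKs x hx)]
    -- Near a point of `S` in the support of `φ`, continuity and `η = 0` on `S` give `‖η / r‖ < 1`;
    -- there the cutoff is `1` and `φ_r = φ`.
    have haway : sectionSupport ⇑(φ - φr).1 ⊆ Sᶜ := by
      intro x hx hxS
      refine notMem_sectionSupport_iff.2 ?_ hx
      by_cases hxK : x ∈ K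
      · obtain ⟨⟨hxU, -⟩, hxj⟩ := hφ hxK
        have hc : ContinuousAt (fun z => ‖r⁻¹ • η (chartAt 𝔼 p z)‖) x :=
          (ContinuousAt.comp (f := chartAt 𝔼 p) hηr.continuous.continuousAt
            ((chartAt 𝔼 p).continuousAt hxj.1.1)).norm
        have h0 : ‖r⁻¹ • η (chartAt 𝔼 p x)‖ < 1 := by
          rw [hηS x hxU hxS, smul_zero, norm_zero]
          exact zero_lt_one' ℝ
        have hlt := hc.eventually (Iio_mem_nhds h0)
        filter_upwards [hlt] with z hz
        have h1 : φr.1 z = φ.1 z := by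
          rw [hφr, ← hfφ]
          unfold sectionOfLocal
          simp only [fr, hχ1 _ (le_of_lt hz), one_smul]
        change φ.1 z - φr.1 z = 0
        rw [h1, sub_self]
      · filter_upwards [notMem_sectionSupport_iff.1 hxK,
          notMem_sectionSupport_iff.1 fun h => hxK (hφrK h)] with z hz hz'
        change φ.1 z - φr.1 z = 0
        rw [hz, hz', sub_self]
    have heq : T.eval (formalDual vol L univ φ) = T.eval (formalDual vol L univ φr) := by
      rw [← sub_eq_zero, ← map_sub, ← map_sub]
      exact eval_formalDual_eq_zero_of_subset hL hvol hu hT _ haway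
    have hΨ := formalDual_testSectionOfLocal hL hvol D hfrs hfrc hfrU φr hφr
    have hadj := D.tsupport_adjoint_subset fr
    rw [heq, hT]
    refine (enorm_integral_le_lintegral_enorm _).trans (enorm_setIntegral_dual_apply_le
      hSclosed.isOpen_compl.measurableSet (fun x hx w => ?_) fun x hxS hxA => ?_)
    · have hxp : x ∈ patch (n := n) (F →L[ℝ] ℝ) (Dual E) p := by
        rw [patch_dual]
        exact (hφ hx.2).2.1
      refine ((hφ hx.2).1.2 _ w).trans ?_
      rw [show (⇑(formalDual vol L univ φr).1 : ∀ x, Dual E x) =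
        sectionOfLocal (Dual E) p (D.adjoint fr) from funext hΨ,
        localRep_sectionOfLocal _ (mem_image_of_mem _ hxp), mul_assoc _ C']
      gcongr
      exact hB r hr hr1 _
    · rw [hΨ]
      refine sectionOfLocal_eq_zero fun hxs => image_eq_zero_of_notMem_tsupport fun h => hxA ?_
      have hxK : x ∈ K := hmemK hxs (hfrt (hadj h))
      refine ⟨⟨?_, hxS⟩, hxK⟩
      refine (hηd x (hφ hxK).1.1).trans (ENNReal.ofReal_le_ofReal ?_)
      gcongr
      -- If `‖η‖ > 2 r` at a point, the same holds nearby, so `χ(η / r)` vanishes near that point,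
      -- which then lies outside the support of `fr` and of its adjoint.
      by_contra! hlt
      refine notMem_tsupport_iff_eventuallyEq.2 ?_ (hadj h)
      filter_upwards [hη.continuous.norm.continuousAt.eventually (lt_mem_nhds hlt)] with y hy
      have h2 : 2 ≤ ‖r⁻¹ • η y‖ := by
        rw [norm_smul, norm_inv, Real.norm_of_nonneg hr.le, inv_mul_eq_div, le_div_iff₀ hr]
        exact hy.le
      simp only [fr, hχ0 _ h2, zero_smul, Pi.zero_apply]
  -- the limit `r → 0`
  set c := B * C' * (C * 2) ^ k
  have hc : 0 ≤ c := by positivity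
  have hle (ε : ℝ) (hε : 0 < ε) : |T.eval (formalDual vol L univ φ)| ≤ c * ε := by
    have htend : Tendsto (fun r : ℝ => C * (2 * r)) (𝓝[>] 0) (𝓝[>] 0) := by
      refine tendsto_nhdsWithin_iff.2 ⟨?_, ?_⟩
      · have : ContinuousAt (fun r : ℝ => C * (2 * r)) 0 := by fun_prop
        simpa using this.tendsto.mono_left nhdsWithin_le_nhds
      · filter_upwards [self_mem_nhdsWithin] with r (hr : 0 < r)
        exact mul_pos hC (mul_pos two_pos hr)
    -- The decay hypothesis is applied at radius `2 C r`. Its bound `ε (2 C r) ^ k` cancels `r⁻ᵏ`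
    -- and leaves the factor `(2 C) ^ k` of `c`.
    obtain ⟨r, h1, hr, hr1⟩ := ((htend.eventually (hsmall K hK ε hε)).and
      (Ioc_mem_nhdsGT one_pos)).exists
    have h2 := (key r hr hr1).trans (mul_le_mul_right h1 _)
    rw [← ENNReal.ofReal_mul (by positivity), Real.enorm_eq_ofReal_abs,
      ENNReal.ofReal_le_ofReal_iff (by positivity)] at h2
    refine h2.trans_eq ?_
    simp only [c, mul_pow, inv_pow]
    field_simp
  by_contra hne
  have hpos := abs_pos.2 hne
  have h := hle (|T.eval (formalDual vol L univ φ)| / (c + 1)) (by positivity)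
  rw [mul_div_assoc', le_div_iff₀ (by positivity)] at h
  nlinarith

end Extension

end DiffOp

end

/-! ### The removable singularity theorem -/

theorem theorem5p1
    {n : ℕ} {M : Type*} [EMetricSpace M] [SecondCountableTopology M]
    [ChartedSpace (EuclideanSpace ℝ (Fin n)) M] [IsManifold (𝓡 n) ∞ M]
    -- `M` is a Riemannian manifold and the distance of `M` is the Riemannian distance
    [RiemannianBundle (fun x : M => TangentSpace (𝓡 n) x)]
    [IsContMDiffRiemannianBundle (𝓡 n) ∞ (EuclideanSpace ℝ (Fin n))
      (fun x : M => TangentSpace (𝓡 n) x)]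
    [IsRiemannianManifold (𝓡 n) M]
    -- `vol` is a smooth positive density, for example the Riemannian volume
    [MeasurableSpace M] [BorelSpace M] (vol : Measure M)
    (hvol : DiffOp.IsSmoothPositiveDensity n vol)
    -- `E` is a real vector bundle with a Riemannian metric
    {F : Type*} [NormedAddCommGroup F] [NormedSpace ℝ F] [FiniteDimensional ℝ F]
    {E : M → Type*} [∀ x, NormedAddCommGroup (E x)] [∀ x, InnerProductSpace ℝ (E x)]
    [TopologicalSpace (TotalSpace F E)] [FiberBundle F E] [VectorBundle ℝ F E]
    [ContMDiffVectorBundle ∞ F E (𝓡 n)] [IsContMDiffRiemannianBundle (𝓡 n) ∞ F E]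
    -- `E'` is a real vector bundle
    {F' : Type*} [NormedAddCommGroup F'] [NormedSpace ℝ F'] [FiniteDimensional ℝ F']
    {E' : M → Type*} [∀ x, AddCommGroup (E' x)] [∀ x, Module ℝ (E' x)]
    [∀ x, TopologicalSpace (E' x)]
    [TopologicalSpace (TotalSpace F' E')] [FiberBundle F' E'] [VectorBundle ℝ F' E']
    [ContMDiffVectorBundle ∞ F' E' (𝓡 n)]
    -- `L` is a weakly hypoelliptic operator of order `k ≥ 1`
    (k : ℕ) (hk : 1 ≤ k) (L : Cₛ^∞⟮𝓡 n; F, E⟯ →ₗ[ℝ] Cₛ^∞⟮𝓡 n; F', E'⟯)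
    (hL : DiffOp.IsDiffOp k L) (hyp : DiffOp.IsWeaklyHypoelliptic vol L)
    -- `S` is an embedded submanifold of codimension `m ≥ 1`, with `M \ S` open
    (m : ℕ) (hm : 1 ≤ m) (S : Set M) (hSclosed : IsClosed S)
    (hS : DiffOp.IsEmbeddedSubmanifold n m S)
    -- `u` is a solution on `M \ S` with `‖u‖_{L¹(N(S,r) ∩ K)} = o(r^k)` for all compact `K`
    (u : ∀ x, E x) (hu : u ∈ DiffOp.solutions vol L Sᶜ)
    (hsmall : ∀ K : Set M, IsCompact K → ∀ ε : ℝ, 0 < ε → ∀ᶠ r : ℝ in 𝓝[>] 0,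
      ∫⁻ x in DiffOp.puncturedNbhd S r ∩ K, ‖u x‖ₑ ∂vol ≤ ENNReal.ofReal (ε * r ^ k)) :
    ∃! v : ∀ x, E x, v ∈ DiffOp.solutions vol L Set.univ ∧ ∀ x, x ∉ S → v x = u x := by
  have : IsContinuousRiemannianBundle (EuclideanSpace ℝ (Fin n))
      (fun x : M => TangentSpace (𝓡 n) x) := by
    obtain ⟨g, hg, h⟩ := IsContMDiffRiemannianBundle.exists_contMDiff (IB := 𝓡 n) (n := ∞)
      (F := EuclideanSpace ℝ (Fin n)) (E := fun x : M => TangentSpace (𝓡 n) x)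
    exact ⟨g, hg.continuous, h⟩
  have : IsContinuousRiemannianBundle F E := by
    obtain ⟨g, hg, h⟩ := IsContMDiffRiemannianBundle.exists_contMDiff (IB := 𝓡 n) (n := ∞)
      (F := F) (E := E)
    exact ⟨g, hg.continuous, h⟩
  have := ChartedSpace.locallyCompactSpace (EuclideanSpace ℝ (Fin n)) M
  have := hvol.isLocallyFiniteMeasure
  have := hvol.isOpenPosMeasure
  obtain ⟨T₀, ⟨husm, -⟩, -⟩ := id hu
  have hSo := hSclosed.isOpen_compl
  -- the distributional section over `M` given by `u`
  obtain ⟨T, hT⟩ := DiffOp.exists_distSection_setIntegral (vol := vol) hSo husm fun K hK => by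
    -- Finiteness of the integral at a single radius is enough here, so `ε = 1` serves.
    obtain ⟨r, h, hr⟩ := ((hsmall K hK 1 one_pos).and self_mem_nhdsWithin).exists
    exact DiffOp.lintegral_enorm_ne_top husm hK hr (h.trans_lt ENNReal.ofReal_lt_top).ne
  have hLT : DiffOp.applyDist vol L univ T = 0 := by
    have hloc (p : M) : ∃ V ∈ 𝓝 p,
        ∀ φ : DiffOp.testSections (n := n) (F' →L[ℝ] ℝ) (DiffOp.Dual E') univ,
        DiffOp.sectionSupport ⇑φ.1 ⊆ V → T.eval (DiffOp.formalDual vol L univ φ) = 0 := by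
      by_cases hp : p ∈ S
      · exact DiffOp.exists_nhds_eval_formalDual_eq_zero hL hvol hSclosed hS hu hsmall hT hp
      · exact ⟨Sᶜ, hSo.mem_nhds hp,
          DiffOp.eval_formalDual_eq_zero_of_subset hL hvol hu hT⟩
    choose V hV hVT using hloc
    ext φ
    -- The equation `L T = 0` is local: a partition of unity splits `φ` into pieces, each supported
    -- in one of the neighbourhoods `V p`.
    obtain ⟨s, ψ, hφ, hψ⟩ := DiffOp.exists_sum_testSections φ hV
    change T.eval (DiffOp.formalDual vol L univ φ) = 0
    rw [hφ, map_sum, map_sum]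
    exact Finset.sum_eq_zero fun p hp => hVT p _ ((hψ p hp).trans inter_subset_right)
  obtain ⟨v, hv⟩ := hyp univ isOpen_univ T hLT
  have hvu (x : M) (hx : x ∉ S) : v x = u x := by
    -- Off `S` both `v` and `u` represent `T`, so their pairings with test sections supported there
    -- agree.
    refine DiffOp.eqOn_of_forall_integral_eq (vol := vol) hSo (hv.1.mono (subset_univ _)) husm
      (fun φ => ?_) hx
    have h := hv.2 (DiffOp.testSectionsMono _ _ (subset_univ _) φ)
    rw [hT] at h
    exact h.symm.trans (DiffOp.setIntegral_dual_apply_eq φ u)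
  refine ⟨v, ⟨⟨T, hv, hLT⟩, hvu⟩, ?_⟩
  rintro w ⟨⟨Tw, hw, -⟩, hwu⟩
  exact DiffOp.eq_of_dense hw.1 hv.1 (hS.dense_compl hm) fun x hx =>
    (hwu x hx).trans (hvu x hx).symm
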